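/- **Setting (Directed-MCD).** Let $n\ge 3$ and consider the directed line with nodes $0,1,\dots,n$ and edges $(v,v+1)$, with an origin node $o\in\{0,\dots,n\}$. The time-line graph has the replicas $(v,t)$, $t\in\mathbb N$, horizontal (delivery) edges $((v,t),(v+1,t))$ and arcs (storage edges) $((v,t),(v,t+1))$. An instance is a finite sequence $R=(r_1,\dots,r_N)$ of requests $r_i=(v_i,t_i)$ with $o\le v_i\le n$ and $t_1\le\dots\le t_N$. A feasible solution is a finite set of edges that contains a directed path from $(o,0)$ to every request; its cost is its number of edges, and $\mathrm{OPT}(R)$ is the minimum cost. The replicas of a solution are $(o,0)$ and the endpoints of its edges. An online algorithm sees, for $t=0,1,2,\dots$, first the requests of time $t$ one by one and then a clock event. Upon a request $(v,t)$ it must add the horizontal path to $(v,t)$ from some replica $(w,t)$, $w\le v$, already in its solution; upon the clock event of time $t$ it adds arcs $((w,t),(w,t+1))$ for a nonempty set of nodes $w$ with $(w,t)$ already in its solution. Its decisions depend only on the events so far, and nothing is ever deleted. The final solution on $R$ is the one after the clock event of time $t_N$. **Algorithm Square** (pseudo online). Put $t_0=0$ and start with the solution $\{(o,0)\}$ without edges.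 For $i=1,\dots,N$: add the arcs from $(o,t_{i-1})$ to $(o,t_i)$. Let $\rho_i$ be the least directed $L_\infty$ distance $\max(v_i-u,\,t_i-s)$ over all replicas $(u,s)$ of the solution with $u\le v_i$, $s\le t_i$. Among the replicas of the solution with $v_i-5\rho_i\le u\le v_i$ and $t_i-5\rho_i\le s\le t_i$, choose one, $(u_i,s_i)$, whose node $u_i$ is leftmost. Add the arcs from $(u_i,s_i)$ to $(u_i,t_i)$, the horizontal path from $(u_i,t_i)$ to $(v_i,t_i)$, and the arcs from $(u_i,t_i)$ to $(u_i,t_i+4\rho_i)$. Let $\mathrm{Base}$ be the set of all $(w,t_i)$ with $u_i\le w\le v_i$, and $\mathrm{Tail}$ the set of all $(u_i,t)$ with $t_i\le t\le t_i+4\rho_i$. **Algorithm $D^{\mathrm{on}}_\delta$** (with integer base $\delta\ge2$). For $l=0,\dots,\lceil\log_\delta n\rceil$, partition $\{1,\dots,n\}$ into the level-$l$ intervals $\{(j-1)\delta^l+1,\dots,j\delta^l\}\cap\{1,\dots,n\}$, $j\ge1$. The left neighbor of the $j$-th interval is the $(j-1)$-st one, and $\{0\}$ if $j=1$. For $v\ge1$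 let $N^l(v)$ be the set of nodes $u\le v$ that lie in the level-$l$ interval of $v$ or in its left neighbor. Let $C_0=\{o\}$. At time $t$, for each request $r_i=(v_i,t)$ simulate Square to find $u_i$, and add the horizontal path to $(v_i,t)$ from the closest replica $(w,t)$, $w\le u_i$, of time $t$ already in the solution. At the clock event of time $t$ start with $C_{t+1}=\{o\}\cup\{u:(u,t)\in\mathrm{Tail}\}$; for $l=0,1,\dots,\lceil\log_\delta n\rceil$ in increasing order and, within each level, for $v=1,\dots,n$ in increasing order: if $\mathrm{Base}\cup\mathrm{Tail}$ contains a replica of $v$ with a time in $[t-\delta^l+1,t]$ and $C_{t+1}\cap N^l(v)=\emptyset$, add to $C_{t+1}$ some node $u\in N^l(v)$ with $u\in C_t$ or $(u,t)\in\mathrm{Base}$. Then add the arcs $((w,t),(w,t+1))$, $w\in C_{t+1}$, to the solution. The algorithm Dlineon is $D^{\mathrm{on}}_\delta$ with $\delta=\left\lceil\frac{\log n}{\log\log n}\right\rceil$ (logarithms to base 2). **Theorem.** There is an absolute constant $K>0$ such that the following holds, however the choices left open above are made. 1. For all $n\ge3$ and all $o\in\{0,\dots,n\}$, Dlineon is an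 online algorithm for Directed-MCD; its solution is feasible for every instance; and it is $O\!\left(\frac{\log n}{\log\log n}\right)$-competitive: $$\mathrm{cost}(\text{Dlineon},R)\le K\,\frac{\log n}{\log\log n}\cdot\mathrm{OPT}(R)$$ for every instance $R$ that has at least one request different from $(o,0)$ (equivalently, $\mathrm{OPT}(R)>0$). 2. For all integers $2\le\delta\le n$, all $o\in\{0,\dots,n\}$ and every such $R$, the solution of $D^{\mathrm{on}}_\delta$ on $R$ has at most $K\,\delta\cdot\mathrm{cost}(\text{Square},R)$ horizontal edges (delivery cost) and at most $K\,\log_\delta n\cdot\mathrm{cost}(\text{Square},R)$ arcs (storage cost). Here Square makes the same choices as in the simulation, and the definitions above are used for all $n\ge 2$ in part 2. -/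

import Mathlib

namespace DMCD

/-! ### The network-time grid and the problem -/

/-- A replica `(v, t)`: network node `v` at time `t`. -/
abbrev Replica := ℕ × ℕ

/-- A directed edge between two replicas. -/
abbrev Edge := Replica × Replica

/-- A horizontal (delivery) edge `((v, t), (v + 1, t))`. -/
def IsHorizontal (e : Edge) : Prop := e.2 = (e.1.1 + 1, e.1.2)

/-- A vertical (storage) edge, called an arc, `((v, t), (v, t + 1))`. -/
def IsArc (e : Edge) : Prop := e.2 = (e.1.1, e.1.2 + 1)

instance : DecidablePred IsHorizontal := fun e => inferInstanceAs (Decidable (e.2 = _))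

instance : DecidablePred IsArc := fun e => inferInstanceAs (Decidable (e.2 = _))

/-- The edges of the time-line graph over the directed line with nodes `0, 1, ..., n`. -/
def gridEdges (n : ℕ) : Set Edge :=
  {e | (IsHorizontal e ∨ IsArc e) ∧ e.1.1 ≤ n ∧ e.2.1 ≤ n}

/-- A finite set `F` of edges contains a directed path from `p` to `q`. -/
def Reaches (F : Finset Edge) (p q : Replica) : Prop :=
  Relation.ReflTransGen (fun a b => (a, b) ∈ F) p q

/-- `F` is a feasible solution for the requests `R` and the origin node `o`. -/
def Feasible (n o : ℕ) (R : List Replica) (F : Finset Edge) : Prop :=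
  (∀ e ∈ F, e ∈ gridEdges n) ∧ ∀ r ∈ R, Reaches F (o, 0) r

/-- The minimum number of edges of a feasible solution. -/
noncomputable def opt (n o : ℕ) (R : List Replica) : ℕ :=
  sInf {k | ∃ F : Finset Edge, Feasible n o R F ∧ F.card = k}

/-- An instance: a finite sequence of requests, with non-decreasing times, at nodes of the line
that can be reached from the origin. -/
def IsInstance (n o : ℕ) (R : List Replica) : Prop :=
  R.Pairwise (fun r r' => r.2 ≤ r'.2) ∧ ∀ r ∈ R, o ≤ r.1 ∧ r.1 ≤ n

/-- The replicas of a solution: the origin replica and the endpoints of its edges. -/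
def replicas (o : ℕ) (F : Finset Edge) : Finset Replica :=
  insert (o, 0) (F.image Prod.fst ∪ F.image Prod.snd)

/-- The horizontal path from `(u, t)` to `(v, t)`. -/
def horPath (u v t : ℕ) : Finset Edge :=
  (Finset.Ico u v).image fun w => ((w, t), (w + 1, t))

/-- The path of arcs from `(v, s)` to `(v, t)`. -/
def arcPath (v s t : ℕ) : Finset Edge :=
  (Finset.Ico s t).image fun x => ((v, x), (v, x + 1))

/-- The number of horizontal edges. -/
def deliveryCost (F : Finset Edge) : ℕ := (F.filter IsHorizontal).card

/-- The number of arcs. -/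
def storageCost (F : Finset Edge) : ℕ := (F.filter IsArc).card

/-! ### Online algorithms -/

/-- An event: the arrival of a request at a node at the current time, or the clock event which
says that no further requests for the current time will arrive. -/
inductive Event where
  | request (v : ℕ)
  | tick

/-- A history: the events so far, *the latest one first*. -/
abbrev History := List Event

/-- The current time: the number of clock events so far. -/
def History.time : History → ℕ
  | [] => 0
  | Event.request _ :: h => History.time h
  | Event.tick :: h => History.time h + 1

/-- The requests of a history, the latest one first. -/
def History.requests : History → List Replica
  | [] => []
  | Event.request v :: h => (v, History.time h) :: History.requests h
  | Event.tick :: h => History.requests h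

/-- All requests of the history are at nodes from the origin `o` to `n`. -/
def History.Valid (n o : ℕ) (h : History) : Prop :=
  ∀ v, Event.request v ∈ h → o ≤ v ∧ v ≤ n

/-- A deterministic algorithm that reads events one by one; its value at a history is the
solution (set of edges) constructed when exactly these events have occurred. -/
abbrev Algorithm := History → Finset Edge

/-- The rules of online Directed-MCD. Upon a request `(v, t)` the algorithm serves it by adding the
horizontal path from some replica `(w, t)` of the current time which is already in the solution.
Upon the clock event of time `t` it chooses a nonempty set of nodes with a replica of time `t` in
the solution and stores copies there until time `t + 1`. Nothing is ever deleted. -/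
def IsOnline (n o : ℕ) (A : Algorithm) : Prop :=
  A [] = ∅ ∧
  ∀ h : History, h.Valid n o →
    (∀ v, o ≤ v → v ≤ n → ∃ w ≤ v, (w, h.time) ∈ replicas o (A h) ∧
      A (Event.request v :: h) = A h ∪ horPath w v h.time) ∧
    ∃ S : Finset ℕ, S.Nonempty ∧ (∀ w ∈ S, (w, h.time) ∈ replicas o (A h)) ∧
      A (Event.tick :: h) = A h ∪ S.image fun w => ((w, h.time), (w, h.time + 1))

/-- The time of the last request (`0` if there is none). -/
def lastTime (R : List Replica) : ℕ := (R.map Prod.snd).foldr max 0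

/-- The history of the times `0, ..., T - 1` on input `R`: in each round the requests of that time
arrive in the order of `R`, and then the clock event takes place. -/
def historyUpTo (R : List Replica) : ℕ → History
  | 0 => []
  | t + 1 =>
      Event.tick :: (((R.filter fun r => r.2 = t).map fun r => Event.request r.1).reverse ++
        historyUpTo R t)

/-- The solution of an algorithm on input `R`, including the round of the last request. -/
def Algorithm.solution (A : Algorithm) (R : List Replica) : Finset Edge :=
  A (historyUpTo R (lastTime R + 1))

/-- `A` is `c`-competitive: its cost is at most `c` times the optimum. Excluded are only the
degenerate instances whose optimum is `0`, those with no request besides the origin replica. -/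
def IsCompetitive (n o : ℕ) (A : Algorithm) (c : ℝ) : Prop :=
  ∀ R, IsInstance n o R → (∃ r ∈ R, r ≠ (o, 0)) →
    ((A.solution R).card : ℝ) ≤ c * (opt n o R : ℝ)

/-! ### The pseudo online algorithm Square -/

/-- A rule for arbitrary choices: it picks an element of each nonempty finite set of numbers, and
the pick may depend on further data of type `α`. -/
structure Selector (α : Type) where
  pick : α → Finset ℕ → ℕ
  pick_mem : ∀ a S, S.Nonempty → pick a S ∈ S

/-- The directed `L_∞` distance. -/
def distInf (p q : Replica) : WithTop ℕ :=
  if p.1 ≤ q.1 ∧ p.2 ≤ q.2 then ((max (q.2 - p.2) (q.1 - p.1) : ℕ) : WithTop ℕ) else ⊤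

/-- What Square keeps: the time of the previous request, its solution, and the sets Base and Tail.
-/
structure SquareState where
  time : ℕ
  sol : Finset Edge
  base : Finset Replica
  tail : Finset Replica

/-- (SQ1) The solution after adding the path of arcs at the origin up to the time of the request. -/
def SquareState.extended (o : ℕ) (s : SquareState) (r : Replica) : Finset Edge :=
  s.sol ∪ arcPath o s.time r.2

/-- (SQ2) The radius of the request `r`. -/
def SquareState.radius (o : ℕ) (s : SquareState) (r : Replica) : ℕ :=
  ((replicas o (s.extended o r)).inf fun q => distInf q r).untopD 0

/-- The replicas of the solution in the square of side `5ρ` with top right corner `r`. -/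
def SquareState.candidates (o : ℕ) (s : SquareState) (r : Replica) : Finset Replica :=
  (replicas o (s.extended o r)).filter
    fun q => distInf q r ≤ ((5 * s.radius o r : ℕ) : WithTop ℕ)

/-- (SQ3) The node of the serving replica: the leftmost one. -/
def SquareState.servingNode (o : ℕ) (s : SquareState) (r : Replica) : ℕ :=
  ((s.candidates o r).inf fun q => (q.1 : WithTop ℕ)).untopD 0

/-- (SQ3) The possible times of the serving replica. -/
def SquareState.servingTimes (o : ℕ) (s : SquareState) (r : Replica) : Finset ℕ :=
  ((s.candidates o r).filter fun q => q.1 = s.servingNode o r).image Prod.snd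

/-- (SQ4), (SQ5): the state after handling request `r = (v, t)` from the serving replica
`(u, x)`, where `u` is the serving node. -/
def SquareState.serve (o : ℕ) (s : SquareState) (r : Replica) (x : ℕ) : SquareState :=
  let u := s.servingNode o r
  let ρ := s.radius o r
  { time := r.2
    sol := s.extended o r ∪ (arcPath u x r.2 ∪ horPath u r.1 r.2) ∪ arcPath u r.2 (r.2 + 4 * ρ)
    base := s.base ∪ (Finset.Icc u r.1).image fun w => (w, r.2)
    tail := s.tail ∪ (Finset.Icc r.2 (r.2 + 4 * ρ)).image fun y => (u, y) }

/-- Square on a sequence of requests, *the latest one first*. The selector `σ` chooses the time of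
the serving replica. -/
def square (o : ℕ) (σ : Selector (List Replica)) : List Replica → SquareState
  | [] => { time := 0, sol := ∅, base := ∅, tail := ∅ }
  | r :: R =>
      let s := square o σ R
      s.serve o r (σ.pick (r :: R) (s.servingTimes o r))

/-- The cost of Square on the requests `R`, which are listed in the order of their arrival. -/
def squareCost (o : ℕ) (σ : Selector (List Replica)) (R : List Replica) : ℕ :=
  (square o σ R.reverse).sol.card

/-! ### The hierarchy of intervals -/

/-- The `j`-th interval (`j ≥ 1`) of level `l` in the partition of `{1, ..., n}` into intervals of
`δ ^ l` nodes; the last one is cut off at `n`. -/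
def interval (n δ l j : ℕ) : Finset ℕ :=
  (Finset.Icc 1 n).filter fun k => (j - 1) * δ ^ l + 1 ≤ k ∧ k ≤ j * δ ^ l

/-- The neighbor of an interval: the interval of its level on its left; `{0}` for the first one. -/
def leftNeighbor (n δ l j : ℕ) : Finset ℕ :=
  if j = 1 then {0} else interval n δ l (j - 1)

/-- The index of the interval of level `l` that contains the node `v ≥ 1`. -/
def intervalIndex (δ l v : ℕ) : ℕ := (v - 1) / δ ^ l + 1

/-- The neighborhood of level `l` of a node `v ≥ 1`. -/
def neighborhood (n δ l v : ℕ) : Finset ℕ :=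
  (leftNeighbor n δ l (intervalIndex δ l v) ∪ interval n δ l (intervalIndex δ l v)).filter
    fun u => u ≤ v

/-! ### The online algorithm -/

/-- Node `v` is stay-active at level `l` at time `t`: Base or Tail contains a replica of `v` with a
time in `[t - δ ^ l + 1, t]`. -/
def StayActive (δ l v t : ℕ) (B : Finset Replica) : Prop :=
  ∃ p ∈ B, p.1 = v ∧ p.2 ≤ t ∧ t < p.2 + δ ^ l

instance (δ l v t : ℕ) (B : Finset Replica) : Decidable (StayActive δ l v t B) :=
  inferInstanceAs (Decidable (∃ p ∈ B, _))

/-- What the online algorithm keeps: the nodes that have stored a copy for the current time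
(`C_t`), and its solution. -/
structure OnlineState where
  copies : Finset ℕ
  sol : Finset Edge

/-- (D1), (D2): delivery to the request `(v, t)` via `(u, t)`, where `u` is the serving node of
Square, from the closest replica of time `t` on the left of `u` (or at `u`) in the solution. -/
def OnlineState.deliver (o : ℕ) (st : OnlineState) (u v t : ℕ) : OnlineState :=
  let w := ((replicas o st.sol).filter fun p => p.2 = t ∧ p.1 ≤ u).sup Prod.fst
  { st with sol := st.sol ∪ horPath w v t }

/-- (S1) for the level `l` and the node `v`; `C` is the part of `C_{t+1}` that has been selected so
far. -/
def select (n δ : ℕ) (τ : Selector (History × ℕ × ℕ)) (h : History) (s : SquareState)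
    (copies : Finset ℕ) (l v : ℕ) (C : Finset ℕ) : Finset ℕ :=
  if StayActive δ l v h.time (s.base ∪ s.tail) ∧ C ∩ neighborhood n δ l v = ∅ then
    insert (τ.pick (h, l, v) ((neighborhood n δ l v).filter
      fun u => u ∈ copies ∨ (u, h.time) ∈ s.base)) C
  else C

/-- The storage phase at the current time: the nodes of `C_{t+1}`. The levels `0, ..., ⌈log_δ n⌉`
are treated in increasing order, and within a level the nodes `1, ..., n` in increasing order. -/
def nextCopies (n o δ : ℕ) (τ : Selector (History × ℕ × ℕ)) (h : History) (s : SquareState)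
    (copies : Finset ℕ) : Finset ℕ :=
  (List.range (Nat.clog δ n + 1)).foldl
    (fun C l => (List.range' 1 n).foldl (fun C v => select n δ τ h s copies l v C) C)
    (insert o ((s.tail.filter fun p => p.2 = h.time).image Prod.fst))

/-- The run of the online algorithm. It simulates Square on the requests that have arrived so far.
-/
def onlineRun (n o δ : ℕ) (σ : Selector (List Replica)) (τ : Selector (History × ℕ × ℕ)) :
    History → OnlineState
  | [] => { copies := {o}, sol := ∅ }
  | Event.request v :: h =>
      (onlineRun n o δ σ τ h).deliver o
        ((square o σ (History.requests h)).servingNode o (v, History.time h)) v (History.time h)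
  | Event.tick :: h =>
      let st := onlineRun n o δ σ τ h
      let C := nextCopies n o δ τ h (square o σ (History.requests h)) st.copies
      { copies := C
        sol := st.sol ∪ C.image fun w => ((w, History.time h), (w, History.time h + 1)) }

/-- The online algorithm for the line with nodes `0, 1, ..., n` and origin `o`, with interval base
`δ`. The selectors `σ` and `τ` make the choices that the algorithm leaves open. -/
def dlineOn (n o δ : ℕ) (σ : Selector (List Replica)) (τ : Selector (History × ℕ × ℕ)) :
    Algorithm :=
  fun h => (onlineRun n o δ σ τ h).sol

/-- `log n / log log n`, with logarithms to base `2`. -/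
noncomputable def logRatio (n : ℕ) : ℝ :=
  Real.logb 2 n / Real.logb 2 (Real.logb 2 n)

/-- The interval base `δ = ⌈log n / log log n⌉`. -/
noncomputable def intervalBase (n : ℕ) : ℕ := ⌈logRatio n⌉₊

end DMCD

/-!
All costs are compared with the sum of the radii `ρ` of Square and the last time `T`.

**Square against the optimum** (`SquareRun.sum_radius_le`). The box of a request is the square of
side `ρ` with the request as its top right corner. Every solution has a path to the request, whose
last `ρ` edges end in the box, so requests with disjoint boxes are paid for by the optimum. If the
boxes of an earlier request `i` and a later one `j` meet, then `j` lies to the left of the serving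
node of `i`, but at distance less than `ρ i` (`SquareRun.Rel`); in particular `i` is served from
nearby, and there was no replica further left in the large square of side `5ρ i`. Therefore either
`j` is served from at least `ρ j` to its left, and its box meets no later box, or `ρ j ≥ 4 ρ i`
(`SquareRun.Rel.radius_le`). In the latter case `i` is charged to the first such `j`. The tails of
length `4ρ` make the time intervals `[t - ρ, t + 4ρ)` of the requests that are charged to the same
`j` disjoint (`SquareRun.sibling_disjoint`), so together they carry at most half of `ρ j`, and the
charges decrease geometrically. The requests that are not charged fall into two families with
disjoint boxes. Altogether the radii sum up to at most `4 OPT`, while Square has at most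
`T + 14 ∑ ρ` edges, and at least `∑ ρ` because serving a request adds `ρ` edges or more.

**Delivery** (`OnlineInvariant.delivery_le`). Square has a replica at the serving node at most `5ρ`
time units ago. On the lowest level with `5ρ ≤ δ ^ l` the serving node is stay-active, and the
online algorithm has a copy at distance less than `2 δ ^ l ≤ 10 δ ρ`.

**Storage** (`storageCost_onlineRun_le`). When a node `v` is selected on level `l`, the origin is not
in its neighborhood, so the path of Square from the origin to the replica that makes `v` stay-active
is longer than `δ ^ l`, and its last `δ ^ l` edges lie in the interval of `v` or its neighbor, within
the last `2 δ ^ l` time units. Since at most one node is selected for each interval, double counting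
bounds the number of selections on one level by a constant times the cost of Square.

Feasibility holds for every online algorithm (`IsOnline.feasible`), and that the algorithm is online
follows from the invariants in `OnlineInvariant`: near each stay-active node there is a copy, which is
either stored from the round before or in Base.
-/

namespace DMCD

/-! ### Amortization of the radii of Square -/

/-- An abstract record of a run of Square on `N` requests. The `i`-th request is `(v i, t i)`, its
radius is `ρ i`, its serving replica is `(u i, s i)`, and `E i` consists of the replicas of the
solution immediately before the request is served, including the origin arcs up to time `t i`. -/
structure SquareRun (o N : ℕ) where
  v : ℕ → ℕ
  t : ℕ → ℕ
  u : ℕ → ℕ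
  s : ℕ → ℕ
  ρ : ℕ → ℕ
  E : ℕ → Set Replica
  mono : ∀ i j, i ≤ j → j < N → t i ≤ t j
  origin_le : ∀ i < N, o ≤ v i
  far : ∀ i < N, ∀ x y, (x, y) ∈ E i → x ≤ v i → y ≤ t i → x + ρ i ≤ v i ∨ y + ρ i ≤ t i
  nearest : ∀ i < N, ∃ x y, (x, y) ∈ E i ∧ x ≤ v i ∧ y ≤ t i ∧ v i ≤ x + ρ i ∧ t i ≤ y + ρ i
  serving_mem : ∀ i < N, (u i, s i) ∈ E i
  serving_le : ∀ i < N, u i ≤ v i ∧ s i ≤ t i ∧ v i ≤ u i + 5 * ρ i ∧ t i ≤ s i + 5 * ρ i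
  leftmost : ∀ i < N, ∀ x y, (x, y) ∈ E i → x ≤ v i → y ≤ t i → v i ≤ x + 5 * ρ i →
    t i ≤ y + 5 * ρ i → u i ≤ x
  mem_zero : ∀ x y, (x, y) ∈ E 0 ↔ x = o ∧ y ≤ t 0
  mem_succ : ∀ i, i + 1 < N → ∀ x y, (x, y) ∈ E (i + 1) ↔ (x, y) ∈ E i ∨
    (y = t i ∧ u i ≤ x ∧ x ≤ v i) ∨ (x = u i ∧ s i ≤ y ∧ y ≤ t i + 4 * ρ i) ∨
    (x = o ∧ t i ≤ y ∧ y ≤ t (i + 1))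

namespace SquareRun

variable {o N : ℕ} (Q : SquareRun o N)

theorem mem_of_le {i j x y : ℕ} (hij : i ≤ j) (hj : j < N) (h : (x, y) ∈ Q.E i) :
    (x, y) ∈ Q.E j := by
  induction j, hij using Nat.le_induction with
  | base => exact h
  | succ k hk ih => exact (Q.mem_succ k hj x y).2 (Or.inl (ih (by omega)))

theorem base_mem {i j x : ℕ} (hij : i < j) (hj : j < N) (h1 : Q.u i ≤ x) (h2 : x ≤ Q.v i) :
    (x, Q.t i) ∈ Q.E j :=
  Q.mem_of_le hij hj ((Q.mem_succ i (by omega) _ _).2 (by simp [h1, h2]))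

theorem tail_mem {i j y : ℕ} (hij : i < j) (hj : j < N) (h1 : Q.t i ≤ y)
    (h2 : y ≤ Q.t i + 4 * Q.ρ i) : (Q.u i, y) ∈ Q.E j :=
  Q.mem_of_le hij hj ((Q.mem_succ i (by omega) _ _).2
    (by have := (Q.serving_le i (by omega)).2.1; right; right; left; omega))

/-- Replicas with a time in the future come from tails (or the origin), so they have been present
without interruption since the current time. -/
theorem mem_of_future {i : ℕ} (hi : i < N) {x y z : ℕ} (h : (x, y) ∈ Q.E i) (h1 : Q.t i ≤ z)
    (h2 : z ≤ y) : (x, z) ∈ Q.E i := by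
  induction i generalizing x y z with
  | zero => rw [Q.mem_zero] at h ⊢; omega
  | succ i ih =>
    have hm := Q.mono i (i + 1) (by omega) hi
    have hs := Q.serving_le i (by omega)
    rw [Q.mem_succ i hi] at h ⊢
    rcases h with h | h | h | h
    · exact Or.inl (ih (by omega) h (by omega) h2)
    · right; left; omega
    · right; right; left; omega
    · right; right; right; omega

/-- Just before request `i` is served, there is no replica to the left of the serving node that is
in the columns of the square and not below the square; future times are included. -/
theorem empty_left {i : ℕ} (hi : i < N) {x y : ℕ} (h : (x, y) ∈ Q.E i) (hx : x < Q.u i)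
    (h1 : Q.v i ≤ x + 5 * Q.ρ i) : y + 5 * Q.ρ i < Q.t i := by
  by_contra hc
  have hs := Q.serving_le i hi
  rcases le_total y (Q.t i) with hy | hy
  · have := Q.leftmost i hi x y h (by omega) hy h1 (by omega); omega
  · have := Q.leftmost i hi x _ (Q.mem_of_future hi h le_rfl hy) (by omega) le_rfl h1 (by omega)
    omega

/-- Request `j` comes after request `i`, lies to the left of its serving node but within its
radius, and its own radius reaches below the time of `i`. This is the only way in which the boxes
of the two requests can intersect. -/
def Rel (i j : ℕ) : Prop :=
  i < j ∧ Q.v i < Q.v j + Q.ρ i ∧ Q.v j < Q.u i ∧ Q.t j < Q.t i + Q.ρ j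

/-- A replica is in the box of request `i`, the square of side `ρ i` whose top right corner is the
request. -/
def InBox (i : ℕ) (p : Replica) : Prop :=
  Q.v i < p.1 + Q.ρ i ∧ p.1 ≤ Q.v i ∧ Q.t i < p.2 + Q.ρ i ∧ p.2 ≤ Q.t i

instance (i : ℕ) : DecidablePred (Q.InBox i) := fun _ => inferInstanceAs (Decidable (_ ∧ _))

theorem rel_of_inBox {i j : ℕ} (hij : i < j) (hj : j < N) {p : Replica} (hi' : Q.InBox i p)
    (hj' : Q.InBox j p) : Q.Rel i j := by
  obtain ⟨a1, a2, a3, a4⟩ := hi'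
  obtain ⟨b1, b2, b3, b4⟩ := hj'
  refine ⟨hij, by omega, ?_, by omega⟩
  by_contra hc
  have hm := Q.mono i j hij.le hj
  have hs := Q.serving_le i (by omega)
  have := Q.far j hj _ _ (Q.base_mem (x := min (Q.v i) (Q.v j)) hij hj (by omega) (by omega))
    (by omega) hm
  omega

/-- The request is served from within less than its radius to the left. Then the nearest replica
is at vertical distance `ρ i`. -/
def Narrow (i : ℕ) : Prop := Q.v i < Q.u i + Q.ρ i

theorem Rel.narrow_left {Q : SquareRun o N} {i j : ℕ} (h : Q.Rel i j) : Q.Narrow i := by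
  obtain ⟨_, h1, h2, _⟩ := h
  unfold Narrow; omega

theorem Narrow.nearest_below {Q : SquareRun o N} {j : ℕ} (hj : j < N) (h : Q.Narrow j) :
    ∃ x y, (x, y) ∈ Q.E j ∧ Q.u j ≤ x ∧ x ≤ Q.v j ∧ y + Q.ρ j = Q.t j := by
  obtain ⟨x, y, hm, h1, h2, h3, h4⟩ := Q.nearest j hj
  have hu := Q.leftmost j hj x y hm h1 h2 (by omega) (by omega)
  have := Q.far j hj x y hm h1 h2
  unfold Narrow at h
  exact ⟨x, y, hm, hu, h1, by omega⟩

/-- If no replica with the property `P` is present when `i` is served, but one is present later, then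
some request `k` adds the first one: by its base, its arcs, or the origin arcs after it. -/
theorem exists_first (P : ℕ → ℕ → Prop) {i j x y : ℕ} (hij : i ≤ j) (hj : j < N)
    (hi : ∀ x y, (x, y) ∈ Q.E i → ¬ P x y) (hP : P x y) (h : (x, y) ∈ Q.E j) :
    ∃ k, i ≤ k ∧ k < j ∧ (∀ x y, (x, y) ∈ Q.E k → ¬ P x y) ∧
      ∃ x y, P x y ∧ ((y = Q.t k ∧ Q.u k ≤ x ∧ x ≤ Q.v k) ∨
        (x = Q.u k ∧ Q.s k ≤ y ∧ y ≤ Q.t k + 4 * Q.ρ k) ∨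
        (x = o ∧ Q.t k ≤ y ∧ y ≤ Q.t (k + 1))) := by
  induction j, hij using Nat.le_induction generalizing x y with
  | base => exact absurd hP (hi x y h)
  | succ m hm ih =>
    by_cases hE : ∃ x y, (x, y) ∈ Q.E m ∧ P x y
    · obtain ⟨x', y', hE, hP'⟩ := hE
      obtain ⟨k, h1, h2, h3⟩ := ih (by omega) hP' hE
      exact ⟨k, h1, by omega, h3⟩
    · push Not at hE
      refine ⟨m, hm, by omega, hE, x, y, hP, ?_⟩
      rw [Q.mem_succ m hj] at h
      exact h.resolve_left fun h => hE x y h hP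

/-- If the later of two related requests is narrow as well, its radius is four times as large: the
nearest replica straight below it would lie in the square of `i`, to the left of the serving node,
so it was added after `i` by the serving arcs of another request, which lead up to a replica that
is even closer. -/
theorem Rel.radius_le {Q : SquareRun o N} {i j : ℕ} (h : Q.Rel i j) (hj : j < N)
    (hn : Q.Narrow j) : 4 * Q.ρ i ≤ Q.ρ j := by
  obtain ⟨hij, h1, h2, h3⟩ := h
  obtain ⟨x, y, hm, hx, hx', hy⟩ := hn.nearest_below hj
  unfold Narrow at hn
  by_contra hc
  have hmono := Q.mono i j hij.le hj
  obtain ⟨k, hk, hkj, -, x', y', ⟨rfl, rfl⟩, hadd⟩ := Q.exists_first (fun a b => a = x ∧ b = y)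
    hij.le hj (fun a b hab ⟨ha, hb⟩ => by
      subst ha hb
      have := Q.empty_left (by omega) hab (by omega) (by omega)
      omega) ⟨rfl, rfl⟩ hm
  have hik := Q.mono i k hk (by omega)
  have hkj' := Q.mono k j hkj.le hj
  have hs := Q.serving_le k (by omega)
  rcases hadd with hadd | hadd | hadd
  · omega
  · have := Q.far j hj _ _ (Q.base_mem hkj hj (le_refl (Q.u k)) (by omega)) (by omega) hkj'
    omega
  · omega

/-- Two requests that are related to the same later one, `j`, and not to each other, occupy
disjoint time intervals. -/
theorem sibling_disjoint {i i' j : ℕ} (hii' : i < i') (hj : j < N) (h : Q.Rel i j)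
    (h' : Q.Rel i' j) (hn : ¬ Q.Rel i i') : Q.t i + 4 * Q.ρ i + Q.ρ i' ≤ Q.t i' := by
  have hw := h'.narrow_left
  obtain ⟨hij, h1, h2, h3⟩ := h
  obtain ⟨hij', h1', h2', h3'⟩ := h'
  have hmii := Q.mono i i' hii'.le (by omega)
  have hmj := Q.mono i' j hij'.le hj
  have hs' := Q.serving_le i' (by omega)
  -- the tail of a request `k` with serving node in `(v j, v i']` keeps the box of `i'` above it
  have key : ∀ k, k < i' → Q.v j < Q.u k → Q.u k ≤ Q.v i' →
      Q.t k + 4 * Q.ρ k + Q.ρ i' ≤ Q.t i' := fun k hk hk1 hk2 => by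
    have hmk := Q.mono k i' hk.le (by omega)
    have := Q.far i' (by omega) _ _ (Q.tail_mem (y := min (Q.t i') (Q.t k + 4 * Q.ρ k)) hk
      (by omega) (by omega) (by omega)) (by omega) (by omega)
    omega
  by_cases hv : Q.u i ≤ Q.v i'
  · exact key i hii' h2 hv
  have ht : Q.t i + Q.ρ i' ≤ Q.t i' := by
    by_contra hc
    exact hn ⟨hii', by omega, by omega, by omega⟩
  obtain ⟨x, y, hm, hx, hx', hy⟩ := hw.nearest_below (by omega)
  obtain ⟨k, hk, hki, hfree, x', y', ⟨hp1, hp2, hp3⟩, hadd⟩ := Q.exists_first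
    (fun a b => Q.v j < a ∧ a ≤ Q.v i' ∧ Q.t i ≤ b + 5 * Q.ρ i) (by omega : i ≤ i') (by omega)
    (fun a b hab ⟨ha, hb, hc⟩ => by
      have := Q.empty_left (by omega) hab (by omega) (by omega)
      omega) (by omega : Q.v j < x ∧ x ≤ Q.v i' ∧ Q.t i ≤ y + 5 * Q.ρ i) hm
  have hs := Q.serving_le k (by omega)
  have hmk := Q.mono i k hk (by omega)
  have hoj := Q.origin_le j hj
  have hmk' := Q.mono k j (by omega) hj
  have huk : Q.u k ≤ Q.v i' := by omega
  -- a base of `k` that crosses the column of `j` would give `j` a smaller radius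
  have hku : Q.v j < Q.u k := by
    by_contra hc
    have := Q.far j hj _ _ (Q.base_mem (x := Q.v j) (by omega) hj (by omega) (by omega)) le_rfl hmk'
    omega
  have := hfree _ _ (Q.serving_mem k (by omega))
  have := key k hki hku huk
  omega

/-- The request `i` is related to a later one with at least four times its radius. -/
def Dominated (i : ℕ) : Prop := ∃ j, j < N ∧ Q.Rel i j ∧ 4 * Q.ρ i ≤ Q.ρ j

open Classical in
/-- The first request by which `i` is dominated. -/
noncomputable def parent (i : ℕ) : ℕ := if h : Q.Dominated i then Nat.find h else 0

theorem parent_spec {i : ℕ} (h : Q.Dominated i) :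
    Q.parent i < N ∧ Q.Rel i (Q.parent i) ∧ 4 * Q.ρ i ≤ Q.ρ (Q.parent i) := by
  classical
  unfold parent
  rw [dif_pos h]
  exact Nat.find_spec h

theorem parent_le {i j : ℕ} (hj : j < N) (h : Q.Rel i j) (h4 : 4 * Q.ρ i ≤ Q.ρ j) :
    Q.parent i ≤ j := by
  classical
  have hd : Q.Dominated i := ⟨j, hj, h, h4⟩
  unfold parent
  rw [dif_pos hd]
  exact Nat.find_min' hd ⟨hj, h, h4⟩

open Classical in
/-- The children of `j` have pairwise disjoint time intervals `[t - ρ, t + 4ρ)`, which are all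
contained in an interval of length `9ρ/4` around `j`. -/
theorem two_mul_sum_children_le {j : ℕ} (hj : j < N) :
    2 * ∑ i ∈ (Finset.range N).filter (fun i => Q.Dominated i ∧ Q.parent i = j), Q.ρ i
      ≤ Q.ρ j := by
  set S := (Finset.range N).filter (fun i => Q.Dominated i ∧ Q.parent i = j) with hS
  let I : ℕ → Finset ℤ := fun i => Finset.Ico ((Q.t i : ℤ) - Q.ρ i) (Q.t i + 4 * Q.ρ i)
  have hspec : ∀ i ∈ S, Q.Rel i j ∧ 4 * Q.ρ i ≤ Q.ρ j := by
    intro i hi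
    simp only [hS, Finset.mem_filter] at hi
    obtain ⟨-, hd, rfl⟩ := hi
    exact (Q.parent_spec hd).2
  have hlt : ∀ i ∈ S, ∀ i' ∈ S, i < i' → Disjoint (I i) (I i') := by
    intro i hi i' hi' hii
    have h1 := hspec i hi
    have h2 := hspec i' hi'
    have hn : ¬ Q.Rel i i' := fun hr => by
      have hi'N : i' < N := by have := h2.1.1; omega
      have := Q.parent_le hi'N hr (hr.radius_le hi'N h2.1.narrow_left)
      simp only [hS, Finset.mem_filter] at hi
      have := h2.1.1
      omega
    have := Q.sibling_disjoint hii hj h1.1 h2.1 hn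
    rw [Finset.disjoint_left]
    intro z hz hz'
    simp only [I, Finset.mem_Ico] at hz hz'
    omega
  have hdisj : (S : Set ℕ).PairwiseDisjoint I := by
    intro i hi i' hi' hne
    rcases lt_or_gt_of_ne hne with h | h
    · exact hlt i hi i' hi' h
    · exact (hlt i' hi' i hi h).symm
  have hsub : S.biUnion I ⊆
      Finset.Ico ((Q.t j : ℤ) - Q.ρ j - (Q.ρ j / 4 : ℕ)) (Q.t j + Q.ρ j) := by
    intro z hz
    obtain ⟨i, hi, hz⟩ := Finset.mem_biUnion.1 hz
    obtain ⟨⟨h1, h2, h3, h4⟩, h5⟩ := hspec i hi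
    have := Q.mono i j h1.le hj
    simp only [I, Finset.mem_Ico] at hz ⊢
    omega
  have hcard := Finset.card_le_card hsub
  rw [Finset.card_biUnion hdisj] at hcard
  have hI : ∀ i ∈ S, (I i).card = 5 * Q.ρ i := fun i _ => by
    simp only [I, Int.card_Ico]; omega
  rw [Finset.sum_congr rfl hI, ← Finset.mul_sum, Int.card_Ico] at hcard
  omega

open Classical in
/-- Geometric decrease: the requests that are not dominated carry at least half of the radii. -/
theorem sum_le_two_mul_sum_not_dominated :
    ∑ i ∈ Finset.range N, Q.ρ i ≤
      2 * ∑ i ∈ (Finset.range N).filter (fun i => ¬ Q.Dominated i), Q.ρ i := by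
  have h1 := Finset.sum_filter_add_sum_filter_not (Finset.range N) (fun i => Q.Dominated i) Q.ρ
  have h2 := Finset.sum_fiberwise_of_maps_to
    (s := (Finset.range N).filter fun i => Q.Dominated i) (t := Finset.range N) (g := Q.parent)
    (fun i hi => Finset.mem_range.2 (Q.parent_spec (Finset.mem_filter.1 hi).2).1) Q.ρ
  have h3 := Finset.sum_le_sum fun j (hj : j ∈ Finset.range N) =>
    Q.two_mul_sum_children_le (Finset.mem_range.1 hj)
  rw [← Finset.mul_sum] at h3
  simp only [Finset.filter_filter] at h2
  omega

/-- If every box of a set of pairwise unrelated requests contains the heads of `ρ` edges of `F`,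
then the radii of these requests add up to at most `|F|`, because the boxes are disjoint. -/
theorem sum_le_card {F : Finset Edge} (S : Finset ℕ) (hS : ∀ i ∈ S, i < N)
    (hrel : ∀ i ∈ S, ∀ j ∈ S, ¬ Q.Rel i j)
    (hF : ∀ i < N, Q.ρ i ≤ (F.filter fun e => Q.InBox i e.2).card) :
    ∑ i ∈ S, Q.ρ i ≤ F.card := by
  have hdisj : (S : Set ℕ).PairwiseDisjoint fun i => F.filter fun e => Q.InBox i e.2 := by
    intro i hi j hj hne
    rw [Function.onFun, Finset.disjoint_left]
    intro e he he'
    rw [Finset.mem_filter] at he he'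
    rcases lt_or_gt_of_ne hne with h | h
    · exact hrel i hi j hj (Q.rel_of_inBox h (hS j hj) he.2 he'.2)
    · exact hrel j hj i hi (Q.rel_of_inBox h (hS i hi) he'.2 he.2)
  calc ∑ i ∈ S, Q.ρ i ≤ ∑ i ∈ S, (F.filter fun e => Q.InBox i e.2).card :=
        Finset.sum_le_sum fun i hi => hF i (hS i hi)
    _ = (S.biUnion fun i => F.filter fun e => Q.InBox i e.2).card :=
        (Finset.card_biUnion hdisj).symm
    _ ≤ F.card := Finset.card_le_card (Finset.biUnion_subset.2 fun i _ => Finset.filter_subset _ _)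

/-- The radii add up to at most four times the size of any set of edges that meets every box in
sufficiently many edges. Undominated requests fall into two families of unrelated requests, the
narrow ones and the others. -/
theorem sum_radius_le {F : Finset Edge}
    (hF : ∀ i < N, Q.ρ i ≤ (F.filter fun e => Q.InBox i e.2).card) :
    ∑ i ∈ Finset.range N, Q.ρ i ≤ 4 * F.card := by
  classical
  have h1 := Q.sum_le_two_mul_sum_not_dominated
  have h2 := Finset.sum_filter_add_sum_filter_not
    ((Finset.range N).filter (fun i => ¬ Q.Dominated i)) (fun i => Q.Narrow i) Q.ρ
  have h3 := Q.sum_le_card (F := F)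
    (((Finset.range N).filter (fun i => ¬ Q.Dominated i)).filter fun i => Q.Narrow i)
    (fun i hi => by simp only [Finset.mem_filter, Finset.mem_range] at hi; exact hi.1.1)
    (fun i hi j hj hr => by
      simp only [Finset.mem_filter, Finset.mem_range] at hi hj
      exact hi.1.2 ⟨j, hj.1.1, hr, hr.radius_le hj.1.1 hj.2⟩) hF
  have h4 := Q.sum_le_card (F := F)
    (((Finset.range N).filter (fun i => ¬ Q.Dominated i)).filter fun i => ¬ Q.Narrow i)
    (fun i hi => by simp only [Finset.mem_filter, Finset.mem_range] at hi; exact hi.1.1)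
    (fun i hi j hj hr => by
      simp only [Finset.mem_filter, Finset.mem_range] at hi hj
      exact hi.2 hr.narrow_left) hF
  omega

end SquareRun

/-! ### Paths in the grid -/

theorem mem_horPath {u v t : ℕ} {e : Edge} :
    e ∈ horPath u v t ↔ ∃ w, u ≤ w ∧ w < v ∧ e = ((w, t), (w + 1, t)) := by
  simp only [horPath, Finset.mem_image, Finset.mem_Ico, and_assoc, eq_comm]

theorem mem_arcPath {v s t : ℕ} {e : Edge} :
    e ∈ arcPath v s t ↔ ∃ x, s ≤ x ∧ x < t ∧ e = ((v, x), (v, x + 1)) := by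
  simp only [arcPath, Finset.mem_image, Finset.mem_Ico, and_assoc, eq_comm]

theorem card_horPath (u v t : ℕ) : (horPath u v t).card = v - u := by
  rw [horPath, Finset.card_image_of_injective _ (fun a b h => by simp at h; omega), Nat.card_Ico]

theorem card_arcPath (v s t : ℕ) : (arcPath v s t).card = t - s := by
  rw [arcPath, Finset.card_image_of_injective _ (fun a b h => by simp at h; omega), Nat.card_Ico]

theorem mem_replicas {o : ℕ} {F : Finset Edge} {p : Replica} :
    p ∈ replicas o F ↔ p = (o, 0) ∨ ∃ e ∈ F, e.1 = p ∨ e.2 = p := by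
  simp only [replicas, Finset.mem_insert, Finset.mem_union, Finset.mem_image]
  constructor
  · rintro (h | ⟨e, he, h⟩ | ⟨e, he, h⟩)
    exacts [Or.inl h, Or.inr ⟨e, he, Or.inl h⟩, Or.inr ⟨e, he, Or.inr h⟩]
  · rintro (h | ⟨e, he, h | h⟩)
    exacts [Or.inl h, Or.inr (Or.inl ⟨e, he, h⟩), Or.inr (Or.inr ⟨e, he, h⟩)]

theorem mem_replicas_union {o : ℕ} {F G : Finset Edge} {p : Replica} :
    p ∈ replicas o (F ∪ G) ↔ p ∈ replicas o F ∨ ∃ e ∈ G, e.1 = p ∨ e.2 = p := by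
  simp only [mem_replicas, Finset.mem_union, or_and_right, exists_or, or_assoc]

theorem replicas_mono {o : ℕ} {F G : Finset Edge} (h : F ⊆ G) : replicas o F ⊆ replicas o G := by
  intro p hp
  rw [← Finset.union_eq_right.2 h]
  exact mem_replicas_union.2 (Or.inl hp)

theorem card_replicas_le (o : ℕ) (F : Finset Edge) : (replicas o F).card ≤ 2 * F.card + 1 := by
  have h1 := Finset.card_insert_le (o, 0) (F.image Prod.fst ∪ F.image Prod.snd)
  have h2 := Finset.card_union_le (F.image Prod.fst) (F.image Prod.snd)
  have h3 := Finset.card_image_le (s := F) (f := Prod.fst)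
  have h4 := Finset.card_image_le (s := F) (f := Prod.snd)
  rw [replicas]
  omega

theorem exists_mem_horPath {u v t : ℕ} {p : Replica} :
    (∃ e ∈ horPath u v t, e.1 = p ∨ e.2 = p) ↔ u < v ∧ u ≤ p.1 ∧ p.1 ≤ v ∧ p.2 = t := by
  obtain ⟨x, y⟩ := p
  constructor
  · rintro ⟨e, he, h⟩
    obtain ⟨w, h1, h2, rfl⟩ := mem_horPath.1 he
    simp only [Prod.mk.injEq] at h
    dsimp only
    omega
  · rintro ⟨h0, h1, h2, h3⟩
    simp only at h1 h2 h3
    subst h3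
    rcases h2.eq_or_lt with rfl | h2
    · exact ⟨_, mem_horPath.2 ⟨x - 1, by omega, by omega, rfl⟩, Or.inr (by
        simp only [Prod.mk.injEq, and_true]; omega)⟩
    · exact ⟨_, mem_horPath.2 ⟨x, h1, h2, rfl⟩, Or.inl rfl⟩

theorem exists_mem_arcPath {v s t : ℕ} {p : Replica} :
    (∃ e ∈ arcPath v s t, e.1 = p ∨ e.2 = p) ↔ s < t ∧ s ≤ p.2 ∧ p.2 ≤ t ∧ p.1 = v := by
  obtain ⟨x, y⟩ := p
  constructor
  · rintro ⟨e, he, h⟩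
    obtain ⟨w, h1, h2, rfl⟩ := mem_arcPath.1 he
    simp only [Prod.mk.injEq] at h
    dsimp only
    omega
  · rintro ⟨h0, h1, h2, h3⟩
    simp only at h1 h2 h3
    subst h3
    rcases h2.eq_or_lt with rfl | h2
    · exact ⟨_, mem_arcPath.2 ⟨y - 1, by omega, by omega, rfl⟩, Or.inr (by
        simp only [Prod.mk.injEq, true_and]; omega)⟩
    · exact ⟨_, mem_arcPath.2 ⟨y, h1, h2, rfl⟩, Or.inl rfl⟩

theorem Reaches.mono {F G : Finset Edge} (h : F ⊆ G) {p q : Replica} (hr : Reaches F p q) :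
    Reaches G p q :=
  Relation.ReflTransGen.mono (fun _ _ he => h he) _ _ hr

theorem reaches_horPath {u v t x : ℕ} (h1 : u ≤ x) (h2 : x ≤ v) :
    Reaches (horPath u v t) (u, t) (x, t) := by
  induction x, h1 using Nat.le_induction with
  | base => exact Relation.ReflTransGen.refl
  | succ x hx ih => exact (ih (by omega)).tail (mem_horPath.2 ⟨x, hx, h2, rfl⟩)

theorem reaches_arcPath {v s t y : ℕ} (h1 : s ≤ y) (h2 : y ≤ t) :
    Reaches (arcPath v s t) (v, s) (v, y) := by
  induction y, h1 using Nat.le_induction with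
  | base => exact Relation.ReflTransGen.refl
  | succ y hy ih => exact (ih (by omega)).tail (mem_arcPath.2 ⟨y, hy, h2, rfl⟩)

/-- All replicas of a solution can be reached from the origin replica. -/
def ReachesAll (o : ℕ) (F : Finset Edge) : Prop := ∀ p ∈ replicas o F, Reaches F (o, 0) p

theorem reachesAll_empty (o : ℕ) : ReachesAll o ∅ := by
  intro p hp
  obtain rfl | ⟨e, he, -⟩ := mem_replicas.1 hp
  · exact Relation.ReflTransGen.refl
  · simp at he

theorem ReachesAll.union {o : ℕ} {F G : Finset Edge} (hF : ReachesAll o F)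
    (hG : ∀ e ∈ G, Reaches (F ∪ G) (o, 0) e.1) : ReachesAll o (F ∪ G) := by
  intro p hp
  obtain h | ⟨e, he, rfl | rfl⟩ := mem_replicas_union.1 hp
  · exact (hF p h).mono Finset.subset_union_left
  · exact hG e he
  · exact (hG e he).tail (Finset.mem_union_right _ he)

theorem ReachesAll.union_horPath {o u v t : ℕ} {F : Finset Edge} (hF : ReachesAll o F)
    (h : (u, t) ∈ replicas o F) : ReachesAll o (F ∪ horPath u v t) :=
  hF.union fun e he => by
    obtain ⟨w, h1, h2, rfl⟩ := mem_horPath.1 he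
    exact ((hF _ h).mono Finset.subset_union_left).trans
      ((reaches_horPath h1 h2.le).mono Finset.subset_union_right)

theorem ReachesAll.union_arcPath {o v s t : ℕ} {F : Finset Edge} (hF : ReachesAll o F)
    (h : (v, s) ∈ replicas o F) : ReachesAll o (F ∪ arcPath v s t) :=
  hF.union fun e he => by
    obtain ⟨w, h1, h2, rfl⟩ := mem_arcPath.1 he
    exact ((hF _ h).mono Finset.subset_union_left).trans
      ((reaches_arcPath h1 h2.le).mono Finset.subset_union_right)

/-- Each edge of a path raises the sum of the coordinates by one, so the path has an edge whose
head has any given sum in between. -/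
theorem Reaches.exists_edge {F : Finset Edge} (hF : ∀ e ∈ F, IsHorizontal e ∨ IsArc e)
    {p q : Replica} (h : Reaches F p q) :
    p.1 ≤ q.1 ∧ p.2 ≤ q.2 ∧ ∀ m, p.1 + p.2 < m → m ≤ q.1 + q.2 →
      ∃ e ∈ F, e.2.1 + e.2.2 = m ∧ e.2.1 ≤ q.1 ∧ e.2.2 ≤ q.2 := by
  induction h with
  | refl => exact ⟨le_rfl, le_rfl, fun m h1 h2 => by omega⟩
  | @tail b c _ he ih =>
    obtain ⟨h1, h2, h3⟩ := ih
    have hbc : b.1 ≤ c.1 ∧ b.2 ≤ c.2 ∧ c.1 + c.2 = b.1 + b.2 + 1 := by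
      rcases hF _ he with h | h
      · simp only [IsHorizontal] at h
        rw [h]; exact ⟨by simp, by simp, by simp; omega⟩
      · simp only [IsArc] at h
        rw [h]; exact ⟨by simp, by simp, by simp; omega⟩
    refine ⟨by omega, by omega, fun m hm hm' => ?_⟩
    rcases hm'.eq_or_lt with rfl | hm'
    · exact ⟨_, he, rfl, le_rfl, le_rfl⟩
    · obtain ⟨e, he, h4, h5, h6⟩ := h3 m hm (by omega)
      exact ⟨e, he, h4, by omega, by omega⟩

/-- The last `k` edges of a path have their heads in the square of side `k` at its end. -/
theorem Reaches.le_card_box {F : Finset Edge} (hF : ∀ e ∈ F, IsHorizontal e ∨ IsArc e)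
    {p q : Replica} (h : Reaches F p q) {k : ℕ} (hk : p.1 + p.2 + k ≤ q.1 + q.2) :
    k ≤ (F.filter fun e => q.1 < e.2.1 + k ∧ e.2.1 ≤ q.1 ∧ q.2 < e.2.2 + k ∧ e.2.2 ≤ q.2).card := by
  have hsub : Finset.Ioc (q.1 + q.2 - k) (q.1 + q.2) ⊆
      (F.filter fun e => q.1 < e.2.1 + k ∧ e.2.1 ≤ q.1 ∧ q.2 < e.2.2 + k ∧ e.2.2 ≤ q.2).image
        fun e => e.2.1 + e.2.2 := by
    intro m hm
    rw [Finset.mem_Ioc] at hm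
    obtain ⟨e, he, h1, h2, h3⟩ := (h.exists_edge hF).2.2 m (by omega) (by omega)
    exact Finset.mem_image.2 ⟨e, Finset.mem_filter.2 ⟨he, by omega⟩, h1⟩
  have := (Finset.card_le_card hsub).trans Finset.card_image_le
  rw [Nat.card_Ioc] at this
  omega

theorem not_isArc_of_isHorizontal {e : Edge} (h : IsHorizontal e) : ¬ IsArc e := by
  intro h'
  simp only [IsHorizontal, IsArc] at h h'
  rw [h] at h'
  simp at h'

theorem horPath_isHorizontal {u v t : ℕ} {e : Edge} (h : e ∈ horPath u v t) : IsHorizontal e := by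
  obtain ⟨w, -, -, rfl⟩ := mem_horPath.1 h
  rfl

theorem arcPath_isArc {v s t : ℕ} {e : Edge} (h : e ∈ arcPath v s t) : IsArc e := by
  obtain ⟨w, -, -, rfl⟩ := mem_arcPath.1 h
  rfl

/-! ### One step of Square -/

theorem distInf_eq {p q : Replica} (h1 : p.1 ≤ q.1) (h2 : p.2 ≤ q.2) :
    distInf p q = ((max (q.2 - p.2) (q.1 - p.1) : ℕ) : WithTop ℕ) := if_pos ⟨h1, h2⟩

theorem distInf_le_coe {p q : Replica} {k : ℕ} : distInf p q ≤ (k : WithTop ℕ) ↔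
    p.1 ≤ q.1 ∧ p.2 ≤ q.2 ∧ q.1 ≤ p.1 + k ∧ q.2 ≤ p.2 + k := by
  unfold distInf
  split_ifs with h
  · rw [Nat.cast_le]; omega
  · refine ⟨fun h' => absurd (top_le_iff.1 h') (WithTop.natCast_ne_top k), fun h' => ?_⟩
    exact absurd ⟨h'.1, h'.2.1⟩ h

namespace SquareState

variable {o : ℕ} {s : SquareState} {r : Replica}

theorem mem_replicas_extended (h0 : (o, s.time) ∈ replicas o s.sol) (ht : s.time ≤ r.2)
    {p : Replica} : p ∈ replicas o (s.extended o r) ↔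
      p ∈ replicas o s.sol ∨ (p.1 = o ∧ s.time ≤ p.2 ∧ p.2 ≤ r.2) := by
  rw [extended, mem_replicas_union, exists_mem_arcPath]
  refine ⟨fun h => h.imp_right fun h => ⟨h.2.2.2, h.2.1, h.2.2.1⟩, ?_⟩
  rintro (h | ⟨h1, h2, h3⟩)
  · exact Or.inl h
  · rcases ht.eq_or_lt with h | h
    · obtain ⟨x, y⟩ := p
      obtain rfl : x = o := h1
      obtain rfl : y = s.time := by dsimp only at h2 h3; omega
      exact Or.inl h0
    · exact Or.inr ⟨h, h2, h3, h1⟩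

theorem inf_distInf_eq_radius (ho : o ≤ r.1) (hr : (o, r.2) ∈ replicas o (s.extended o r)) :
    ((replicas o (s.extended o r)).inf fun q => distInf q r) = (s.radius o r : WithTop ℕ) := by
  have h1 := Finset.inf_le (f := fun q => distInf q r) hr
  rw [distInf_eq (p := (o, r.2)) ho le_rfl] at h1
  rw [radius]
  generalize ((replicas o (s.extended o r)).inf fun q => distInf q r) = a at *
  cases a with
  | top => exact absurd (top_le_iff.1 h1) (WithTop.natCast_ne_top _)
  | coe a => rfl

theorem radius_far (ho : o ≤ r.1) (hr : (o, r.2) ∈ replicas o (s.extended o r)) {p : Replica}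
    (hp : p ∈ replicas o (s.extended o r)) (h1 : p.1 ≤ r.1) (h2 : p.2 ≤ r.2) :
    p.1 + s.radius o r ≤ r.1 ∨ p.2 + s.radius o r ≤ r.2 := by
  have h := Finset.inf_le (f := fun q => distInf q r) hp
  rw [inf_distInf_eq_radius ho hr, distInf_eq h1 h2, Nat.cast_le] at h
  omega

theorem exists_nearest (ho : o ≤ r.1) (hr : (o, r.2) ∈ replicas o (s.extended o r)) :
    ∃ p ∈ replicas o (s.extended o r), p.1 ≤ r.1 ∧ p.2 ≤ r.2 ∧ r.1 ≤ p.1 + s.radius o r ∧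
      r.2 ≤ p.2 + s.radius o r := by
  obtain ⟨p, hp, h⟩ := Finset.exists_mem_eq_inf (replicas o (s.extended o r)) ⟨_, hr⟩
    fun q => distInf q r
  rw [inf_distInf_eq_radius ho hr] at h
  exact ⟨p, hp, distInf_le_coe.1 h.ge⟩

theorem mem_candidates {p : Replica} : p ∈ s.candidates o r ↔
    p ∈ replicas o (s.extended o r) ∧ p.1 ≤ r.1 ∧ p.2 ≤ r.2 ∧ r.1 ≤ p.1 + 5 * s.radius o r ∧
      r.2 ≤ p.2 + 5 * s.radius o r := by
  rw [candidates, Finset.mem_filter, distInf_le_coe]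

theorem candidates_nonempty (ho : o ≤ r.1) (hr : (o, r.2) ∈ replicas o (s.extended o r)) :
    (s.candidates o r).Nonempty := by
  obtain ⟨p, hp, h⟩ := exists_nearest ho hr
  exact ⟨p, mem_candidates.2 ⟨hp, by omega⟩⟩

theorem inf_candidates_eq (hne : (s.candidates o r).Nonempty) :
    ((s.candidates o r).inf fun q => (q.1 : WithTop ℕ)) = (s.servingNode o r : WithTop ℕ) := by
  obtain ⟨q, -, h⟩ := Finset.exists_mem_eq_inf (s.candidates o r) hne
    fun q => (q.1 : WithTop ℕ)
  rw [servingNode, h]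
  rfl

theorem servingNode_le {p : Replica} (hp : p ∈ s.candidates o r) : s.servingNode o r ≤ p.1 := by
  have h := Finset.inf_le (f := fun q : Replica => (q.1 : WithTop ℕ)) hp
  rwa [inf_candidates_eq ⟨p, hp⟩, Nat.cast_le] at h

theorem servingTimes_nonempty (hne : (s.candidates o r).Nonempty) :
    (s.servingTimes o r).Nonempty := by
  obtain ⟨q, hq, h⟩ := Finset.exists_mem_eq_inf (s.candidates o r) hne
    fun q => (q.1 : WithTop ℕ)
  rw [inf_candidates_eq hne, Nat.cast_inj] at h
  exact ⟨q.2, Finset.mem_image.2 ⟨q, Finset.mem_filter.2 ⟨hq, h.symm⟩, rfl⟩⟩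

theorem mem_servingTimes {x : ℕ} :
    x ∈ s.servingTimes o r ↔ (s.servingNode o r, x) ∈ s.candidates o r := by
  simp only [servingTimes, Finset.mem_image, Finset.mem_filter, Prod.exists]
  constructor
  · rintro ⟨a, b, ⟨h, rfl⟩, rfl⟩
    exact h
  · intro h
    exact ⟨_, _, ⟨h, rfl⟩, rfl⟩

theorem mem_replicas_serve {x : ℕ} (hx : (s.servingNode o r, x) ∈ s.candidates o r)
    {p : Replica} : p ∈ replicas o (s.serve o r x).sol ↔ p ∈ replicas o (s.extended o r) ∨
      (p.2 = r.2 ∧ s.servingNode o r ≤ p.1 ∧ p.1 ≤ r.1) ∨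
      (p.1 = s.servingNode o r ∧ x ≤ p.2 ∧ p.2 ≤ r.2 + 4 * s.radius o r) := by
  obtain ⟨h0, h1, h2, h3, h4⟩ := mem_candidates.1 hx
  simp only at h1 h2 h3 h4
  simp only [serve, mem_replicas_union, exists_mem_arcPath, exists_mem_horPath,
    ← Finset.union_assoc]
  constructor
  · rintro (((h | h) | h) | h)
    · exact Or.inl h
    · right; right; omega
    · right; left; omega
    · right; right; omega
  · obtain ⟨a, b⟩ := p
    simp only
    rintro (h | h | h)
    · exact Or.inl (Or.inl (Or.inl h))
    · by_cases hu : s.servingNode o r < r.1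
      · left; right; omega
      · obtain rfl : a = s.servingNode o r := by omega
        by_cases hx' : x < r.2
        · left; left; right; omega
        · obtain rfl : b = x := by omega
          exact Or.inl (Or.inl (Or.inl h0))
    · by_cases hb : b ≤ r.2
      · by_cases hx' : x < r.2
        · left; left; right; omega
        · obtain rfl : b = x := by omega
          rw [h.1]
          exact Or.inl (Or.inl (Or.inl h0))
      · right; omega

/-- The invariants of Square. The field `cover` says that a replica off the origin column belongs to
Base or Tail or is straight below a replica of Base, and `born` says that a tail starts no later
than the time of the latest request, so its part up to the current time has no gaps. -/
structure Invariant (o : ℕ) (s : SquareState) : Prop where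
  origin : (o, s.time) ∈ replicas o s.sol
  le_node : ∀ p ∈ replicas o s.sol, o ≤ p.1
  grid : ∀ e ∈ s.sol, IsHorizontal e ∨ IsArc e
  reaches : ReachesAll o s.sol
  base_sub : s.base ⊆ replicas o s.sol
  base_time : ∀ p ∈ s.base, p.2 ≤ s.time
  tail_sub : s.tail ⊆ replicas o s.sol
  born : ∀ p ∈ s.tail, ∃ b ≤ s.time, b ≤ p.2 ∧ ∀ z, b ≤ z → z ≤ p.2 → (p.1, z) ∈ s.tail
  cover : ∀ p ∈ replicas o s.sol, p.1 = o ∨ p ∈ s.base ∪ s.tail ∨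
    ∃ y, p.2 ≤ y ∧ y ≤ s.time ∧ (p.1, y) ∈ s.base

theorem Invariant.origin_extended (hs : s.Invariant o) (ht : s.time ≤ r.2) :
    (o, r.2) ∈ replicas o (s.extended o r) :=
  (mem_replicas_extended hs.origin ht).2 (Or.inr ⟨rfl, ht, le_rfl⟩)

theorem Invariant.le_node_extended (hs : s.Invariant o) (ht : s.time ≤ r.2) {p : Replica}
    (hp : p ∈ replicas o (s.extended o r)) : o ≤ p.1 := by
  rcases (mem_replicas_extended hs.origin ht).1 hp with h | h
  · exact hs.le_node p h
  · exact h.1.ge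

theorem Invariant.servingNode_mem (hs : s.Invariant o) (ht : s.time ≤ r.2) (ho : o ≤ r.1) :
    o ≤ s.servingNode o r ∧ s.servingNode o r ≤ r.1 ∧
      r.1 ≤ s.servingNode o r + 5 * s.radius o r := by
  obtain ⟨x, hx⟩ := servingTimes_nonempty (candidates_nonempty ho (hs.origin_extended ht))
  obtain ⟨h0, h1, h2, h3, h4⟩ := mem_candidates.1 (mem_servingTimes.1 hx)
  exact ⟨hs.le_node_extended ht h0, h1, h3⟩

theorem Invariant.reaches_extended (hs : s.Invariant o) : ReachesAll o (s.extended o r) :=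
  hs.reaches.union_arcPath hs.origin

theorem mem_base_serve {x : ℕ} {p : Replica} : p ∈ (s.serve o r x).base ↔
    p ∈ s.base ∨ (p.2 = r.2 ∧ s.servingNode o r ≤ p.1 ∧ p.1 ≤ r.1) := by
  obtain ⟨a, b⟩ := p
  simp only [serve, Finset.mem_union, Finset.mem_image, Finset.mem_Icc, Prod.mk.injEq]
  refine or_congr_right ⟨?_, ?_⟩
  · rintro ⟨w, h, rfl, rfl⟩; omega
  · rintro ⟨h1, h2, h3⟩; exact ⟨a, by omega, rfl, h1.symm⟩

theorem mem_tail_serve {x : ℕ} {p : Replica} : p ∈ (s.serve o r x).tail ↔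
    p ∈ s.tail ∨ (p.1 = s.servingNode o r ∧ r.2 ≤ p.2 ∧ p.2 ≤ r.2 + 4 * s.radius o r) := by
  obtain ⟨a, b⟩ := p
  simp only [serve, Finset.mem_union, Finset.mem_image, Finset.mem_Icc, Prod.mk.injEq]
  refine or_congr_right ⟨?_, ?_⟩
  · rintro ⟨w, h, rfl, rfl⟩; omega
  · rintro ⟨h1, h2, h3⟩; exact ⟨b, by omega, h1.symm, rfl⟩

theorem extended_subset_serve {x : ℕ} : s.extended o r ⊆ (s.serve o r x).sol :=
  Finset.subset_union_left.trans Finset.subset_union_left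

theorem sol_subset_serve {x : ℕ} : s.sol ⊆ (s.serve o r x).sol :=
  Finset.subset_union_left.trans extended_subset_serve

theorem Invariant.serve (hs : s.Invariant o) (ht : s.time ≤ r.2) (ho : o ≤ r.1) {x : ℕ}
    (hx : x ∈ s.servingTimes o r) : (s.serve o r x).Invariant o := by
  rw [mem_servingTimes] at hx
  obtain ⟨h0, h1, h2, h3, h4⟩ := mem_candidates.1 hx
  obtain ⟨hou, huv, -⟩ := hs.servingNode_mem ht ho
  have hrep {p : Replica} := mem_replicas_serve hx (p := p)
  have htime : (s.serve o r x).time = r.2 := rfl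
  refine ⟨?_, ?_, ?_, ?_, ?_, ?_, ?_, ?_, ?_⟩
  · exact hrep.2 (Or.inl (hs.origin_extended ht))
  · intro p hp
    rcases hrep.1 hp with h | h | h
    · exact hs.le_node_extended ht h
    · omega
    · omega
  · intro e he
    simp only [SquareState.serve, extended, Finset.mem_union] at he
    rcases he with ((he | he) | he | he) | he
    exacts [hs.grid e he, Or.inr (arcPath_isArc he), Or.inr (arcPath_isArc he),
      Or.inl (horPath_isHorizontal he), Or.inr (arcPath_isArc he)]
  · have e1 := (hs.reaches_extended (r := r)).union_arcPath (t := r.2) h0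
    have m1 : (s.servingNode o r, r.2) ∈
        replicas o (s.extended o r ∪ arcPath (s.servingNode o r) x r.2) := by
      rw [mem_replicas_union, exists_mem_arcPath]
      rcases h2.eq_or_lt with h | h
      · left; rw [← h]; exact h0
      · exact Or.inr ⟨h, h2, le_rfl, rfl⟩
    have e2 := e1.union_horPath (v := r.1) m1
    have e3 := e2.union_arcPath (t := r.2 + 4 * s.radius o r)
      (replicas_mono Finset.subset_union_left m1)
    simpa only [SquareState.serve, Finset.union_assoc] using e3
  · intro p hp
    rcases mem_base_serve.1 hp with h | h
    · exact replicas_mono sol_subset_serve (hs.base_sub h)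
    · exact hrep.2 (Or.inr (Or.inl h))
  · intro p hp
    rcases mem_base_serve.1 hp with h | h
    · exact (hs.base_time p h).trans ht
    · exact h.1.le
  · intro p hp
    rcases mem_tail_serve.1 hp with h | h
    · exact replicas_mono sol_subset_serve (hs.tail_sub h)
    · exact hrep.2 (Or.inr (Or.inr ⟨h.1, h2.trans h.2.1, h.2.2⟩))
  · intro p hp
    rcases mem_tail_serve.1 hp with h | h
    · obtain ⟨b, hb1, hb2, hb3⟩ := hs.born p h
      exact ⟨b, hb1.trans ht, hb2, fun z hz hz' => mem_tail_serve.2 (Or.inl (hb3 z hz hz'))⟩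
    · exact ⟨r.2, le_rfl, h.2.1,
        fun z hz hz' => mem_tail_serve.2 (Or.inr ⟨h.1, hz, hz'.trans h.2.2⟩)⟩
  · intro p hp
    rcases hrep.1 hp with h | h | h
    · rcases (mem_replicas_extended hs.origin ht).1 h with h | h
      · rcases hs.cover p h with h | h | ⟨y, hy1, hy2, hy3⟩
        · exact Or.inl h
        · right; left
          rw [Finset.mem_union] at h ⊢
          exact h.imp (fun h => mem_base_serve.2 (Or.inl h)) fun h => mem_tail_serve.2 (Or.inl h)
        · exact Or.inr (Or.inr ⟨y, hy1, hy2.trans ht, mem_base_serve.2 (Or.inl hy3)⟩)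
      · exact Or.inl h.1
    · exact Or.inr (Or.inl (Finset.mem_union_left _ (mem_base_serve.2 (Or.inr h))))
    · right
      rcases le_total p.2 r.2 with hp2 | hp2
      · exact Or.inr ⟨r.2, hp2, le_rfl, mem_base_serve.2 (Or.inr ⟨rfl, h.1.ge, h.1.le.trans huv⟩)⟩
      · exact Or.inl (Finset.mem_union_right _ (mem_tail_serve.2 (Or.inr ⟨h.1, hp2, h.2.2⟩)))

/-- Serving a request adds at least `ρ` edges. If the serving node is at distance at least `ρ`, these
are the last edges of the horizontal path, and otherwise the last arcs at the serving node: their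
heads are at distance less than `ρ` from the request, so they were not in the solution. -/
theorem Invariant.card_add_radius_le (hs : s.Invariant o) (ht : s.time ≤ r.2) (ho : o ≤ r.1)
    {x : ℕ} (hx : x ∈ s.servingTimes o r) :
    s.sol.card + s.radius o r ≤ (s.serve o r x).sol.card := by
  rw [mem_servingTimes] at hx
  obtain ⟨h0, h1, h2, h3, h4⟩ := mem_candidates.1 hx
  simp only at h1 h2 h3 h4
  have hfar {p : Replica} := radius_far ho (hs.origin_extended ht) (p := p)
  have hsub : s.sol.card ≤ (s.extended o r).card := Finset.card_le_card Finset.subset_union_left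
  have hnew : ∀ G : Finset Edge, G ⊆ (s.serve o r x).sol → Disjoint (s.extended o r) G →
      G.card = s.radius o r → s.sol.card + s.radius o r ≤ (s.serve o r x).sol.card := by
    intro G hG hd hc
    have := Finset.card_le_card (Finset.union_subset (extended_subset_serve (x := x)) hG)
    rw [Finset.card_union_of_disjoint hd] at this
    omega
  have hhead : ∀ e ∈ s.extended o r, e.2 ∈ replicas o (s.extended o r) := fun e he =>
    mem_replicas.2 (Or.inr ⟨e, he, Or.inr rfl⟩)
  by_cases hu : s.servingNode o r + s.radius o r ≤ r.1
  · refine hnew (horPath (r.1 - s.radius o r) r.1 r.2) ?_ ?_ ?_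
    · intro e he
      obtain ⟨w, hw1, hw2, rfl⟩ := mem_horPath.1 he
      exact Finset.mem_union_left _ (Finset.mem_union_right _ (Finset.mem_union_right _
        (mem_horPath.2 ⟨w, by omega, hw2, rfl⟩)))
    · rw [Finset.disjoint_right]
      intro e he he'
      obtain ⟨w, hw1, hw2, rfl⟩ := mem_horPath.1 he
      have := hfar (hhead _ he') (by simp only; omega) le_rfl
      simp only at this
      omega
    · rw [card_horPath]; omega
  · have hx' := hfar h0 h1 h2
    simp only at hx'
    refine hnew (arcPath (s.servingNode o r) (r.2 - s.radius o r) r.2) ?_ ?_ ?_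
    · intro e he
      obtain ⟨w, hw1, hw2, rfl⟩ := mem_arcPath.1 he
      exact Finset.mem_union_left _ (Finset.mem_union_right _ (Finset.mem_union_left _
        (mem_arcPath.2 ⟨w, by omega, hw2, rfl⟩)))
    · rw [Finset.disjoint_right]
      intro e he he'
      obtain ⟨w, hw1, hw2, rfl⟩ := mem_arcPath.1 he
      have := hfar (hhead _ he') h1 (by simp only; omega)
      simp only at this
      omega
    · rw [card_arcPath]; omega

theorem card_serve_le {x : ℕ} (hx : x ∈ s.servingTimes o r) :
    (s.serve o r x).sol.card ≤ s.sol.card + (r.2 - s.time) + 14 * s.radius o r := by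
  rw [mem_servingTimes] at hx
  obtain ⟨h0, h1, h2, h3, h4⟩ := mem_candidates.1 hx
  simp only at h1 h2 h3 h4
  have c1 := Finset.card_union_le s.sol (arcPath o s.time r.2)
  have c2 := Finset.card_union_le (arcPath (s.servingNode o r) x r.2)
    (horPath (s.servingNode o r) r.1 r.2)
  have c3 := Finset.card_union_le (s.extended o r)
    (arcPath (s.servingNode o r) x r.2 ∪ horPath (s.servingNode o r) r.1 r.2)
  have c4 := Finset.card_union_le (s.extended o r ∪
    (arcPath (s.servingNode o r) x r.2 ∪ horPath (s.servingNode o r) r.1 r.2))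
    (arcPath (s.servingNode o r) r.2 (r.2 + 4 * s.radius o r))
  simp only [card_arcPath, card_horPath] at c1 c2 c3 c4
  rw [SquareState.serve]
  simp only [extended] at *
  omega

end SquareState

/-! ### Square on a sequence of requests -/

/-- A sequence of requests, the latest one first, with non-decreasing times of arrival and with
nodes that can be reached from the origin. -/
def Arrivals (o : ℕ) (L : List Replica) : Prop :=
  L.Pairwise (fun r r' => r'.2 ≤ r.2) ∧ ∀ r ∈ L, o ≤ r.1

theorem Arrivals.tail {o : ℕ} {r : Replica} {L : List Replica} (h : Arrivals o (r :: L)) :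
    Arrivals o L :=
  ⟨h.1.tail, fun r' hr' => h.2 r' (List.mem_cons_of_mem _ hr')⟩

theorem Arrivals.time_le {o : ℕ} {σ : Selector (List Replica)} {r : Replica} {L : List Replica}
    (h : Arrivals o (r :: L)) : (square o σ L).time ≤ r.2 := by
  cases L with
  | nil => exact Nat.zero_le _
  | cons r' L => exact (List.pairwise_cons.1 h.1).1 r' List.mem_cons_self

theorem square_invariant {o : ℕ} (σ : Selector (List Replica)) {L : List Replica}
    (h : Arrivals o L) : (square o σ L).Invariant o := by
  induction L with
  | nil =>
    have hr : replicas o ∅ = {(o, 0)} := by simp [replicas]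
    constructor <;>
      simp [square, hr, reachesAll_empty]
  | cons r L ih =>
    have hs := ih h.tail
    exact hs.serve h.time_le (h.2 r List.mem_cons_self) (σ.pick_mem _ _
      (SquareState.servingTimes_nonempty (SquareState.candidates_nonempty
        (h.2 r List.mem_cons_self) (hs.origin_extended h.time_le))))

theorem pick_mem_servingTimes {o : ℕ} (σ : Selector (List Replica)) {r : Replica}
    {L : List Replica} (h : Arrivals o (r :: L)) :
    σ.pick (r :: L) ((square o σ L).servingTimes o r) ∈ (square o σ L).servingTimes o r :=
  σ.pick_mem _ _ (SquareState.servingTimes_nonempty (SquareState.candidates_nonempty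
    (h.2 r List.mem_cons_self) ((square_invariant σ h.tail).origin_extended h.time_le)))

/-- The sum of the radii of the requests. -/
def totalRadius (o : ℕ) (σ : Selector (List Replica)) : List Replica → ℕ
  | [] => 0
  | r :: L => totalRadius o σ L + (square o σ L).radius o r

theorem totalRadius_le_card {o : ℕ} (σ : Selector (List Replica)) {L : List Replica}
    (h : Arrivals o L) : totalRadius o σ L ≤ (square o σ L).sol.card := by
  induction L with
  | nil => simp [totalRadius]
  | cons r L ih =>
    have h1 := ih h.tail
    have h2 := (square_invariant σ h.tail).card_add_radius_le h.time_le (h.2 r List.mem_cons_self)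
      (pick_mem_servingTimes σ h)
    simp only [totalRadius, square]
    omega

theorem card_le_totalRadius {o : ℕ} (σ : Selector (List Replica)) {L : List Replica}
    (h : Arrivals o L) :
    (square o σ L).sol.card ≤ (square o σ L).time + 14 * totalRadius o σ L := by
  induction L with
  | nil => simp [square]
  | cons r L ih =>
    have h1 := ih h.tail
    have h2 := SquareState.card_serve_le (pick_mem_servingTimes σ h)
    have h3 := h.time_le (σ := σ)
    have h4 : (square o σ (r :: L)).time = r.2 := rfl
    simp only [totalRadius, h4]
    simp only [square]
    omega

theorem square_sol_subset_cons {o : ℕ} {σ : Selector (List Replica)} {r : Replica}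
    {L : List Replica} : (square o σ L).sol ⊆ (square o σ (r :: L)).sol :=
  SquareState.sol_subset_serve

theorem mem_replicas_square {o : ℕ} (σ : Selector (List Replica)) {L : List Replica}
    (h : Arrivals o L) {r : Replica} (hr : r ∈ L) : r ∈ replicas o (square o σ L).sol := by
  induction L with
  | nil => simp at hr
  | cons r' L ih =>
    rcases List.mem_cons.1 hr with rfl | hr
    · have hx := SquareState.mem_servingTimes.1 (pick_mem_servingTimes σ h)
      exact (SquareState.mem_replicas_serve hx).2
        (Or.inr (Or.inl ⟨rfl, (SquareState.mem_candidates.1 hx).2.1, le_rfl⟩))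
    · exact replicas_mono square_sol_subset_cons (ih h.tail hr)

/-! ### The radii of Square and the optimum -/

section SquareRun

variable {o : ℕ} (σ : Selector (List Replica)) (L : List Replica)

/-- The first `i` requests in the order of arrival, listed with the latest one first, as in `L`. -/
def firstRequests (i : ℕ) : List Replica := L.drop (L.length - i)

/-- The `i`-th request in the order of arrival, counted from `0`. -/
def requestAt (i : ℕ) : Replica := (firstRequests L (i + 1)).headD (0, 0)

variable {L}

theorem firstRequests_zero : firstRequests L 0 = [] := by simp [firstRequests]

theorem firstRequests_length : firstRequests L L.length = L := by simp [firstRequests]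

theorem firstRequests_succ {i : ℕ} (hi : i < L.length) :
    firstRequests L (i + 1) = requestAt L i :: firstRequests L i := by
  have h : firstRequests L (i + 1) =
      L[L.length - (i + 1)]'(by omega) :: firstRequests L i := by
    rw [firstRequests, firstRequests, List.drop_eq_getElem_cons (by omega)]
    congr 2
    omega
  rw [requestAt, h, List.headD_cons]

theorem requestAt_mem {i : ℕ} (hi : i < L.length) : requestAt L i ∈ L := by
  have h : requestAt L i ∈ firstRequests L (i + 1) := by
    rw [firstRequests_succ hi]; exact List.mem_cons_self
  exact List.mem_of_mem_drop h

theorem Arrivals.firstRequests (h : Arrivals o L) (i : ℕ) : Arrivals o (firstRequests L i) :=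
  ⟨h.1.drop, fun r hr => h.2 r (List.mem_of_mem_drop hr)⟩

theorem Arrivals.requestAt_cons (h : Arrivals o L) {i : ℕ} (hi : i < L.length) :
    Arrivals o (requestAt L i :: DMCD.firstRequests L i) := by
  rw [← firstRequests_succ hi]
  exact h.firstRequests _

open SquareState in
/-- The run of Square on a sequence of requests. -/
noncomputable def squareRun (h : Arrivals o L) : SquareRun o L.length where
  v i := (requestAt L i).1
  t i := (requestAt L i).2
  u i := (square o σ (firstRequests L i)).servingNode o (requestAt L i)
  s i := σ.pick (requestAt L i :: firstRequests L i)
    ((square o σ (firstRequests L i)).servingTimes o (requestAt L i))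
  ρ i := (square o σ (firstRequests L i)).radius o (requestAt L i)
  E i := {p | p ∈ replicas o ((square o σ (firstRequests L i)).extended o (requestAt L i))}
  mono i j hij hj := by
    induction j, hij using Nat.le_induction with
    | base => exact le_rfl
    | succ k hk ih =>
      refine (ih (by omega)).trans ?_
      have h' := h.requestAt_cons hj
      rw [firstRequests_succ (by omega)] at h'
      exact (List.pairwise_cons.1 h'.1).1 _ List.mem_cons_self
  origin_le i hi := h.2 _ (requestAt_mem hi)
  far i hi x y hp h1 h2 := by
    have hc := h.requestAt_cons hi
    exact radius_far (h.2 _ (requestAt_mem hi))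
      ((square_invariant σ hc.tail).origin_extended hc.time_le) hp h1 h2
  nearest i hi := by
    have hc := h.requestAt_cons hi
    obtain ⟨⟨x, y⟩, hp, h1, h2, h3, h4⟩ := exists_nearest (h.2 _ (requestAt_mem hi))
      ((square_invariant σ hc.tail).origin_extended hc.time_le)
    exact ⟨x, y, hp, h1, h2, h3, h4⟩
  serving_mem i hi := (mem_candidates.1 (mem_servingTimes.1
    (pick_mem_servingTimes σ (h.requestAt_cons hi)))).1
  serving_le i hi := (mem_candidates.1 (mem_servingTimes.1
    (pick_mem_servingTimes σ (h.requestAt_cons hi)))).2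
  leftmost i hi x y hp h1 h2 h3 h4 := servingNode_le (p := (x, y))
    (mem_candidates.2 ⟨hp, h1, h2, h3, h4⟩)
  mem_zero x y := by
    rw [Set.mem_ofPred_eq, firstRequests_zero]
    rw [mem_replicas_extended (square_invariant σ ⟨List.Pairwise.nil, by simp⟩).origin
      (Nat.zero_le _)]
    simp only [square, replicas, Finset.image_empty, Finset.union_empty, insert_empty_eq,
      Finset.mem_singleton, Prod.mk.injEq]
    omega
  mem_succ i hi x y := by
    have hc := h.requestAt_cons hi
    have hc' := h.requestAt_cons (i := i) (by omega)
    have hx := mem_servingTimes.1 (pick_mem_servingTimes σ hc')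
    rw [Set.mem_ofPred_eq, mem_replicas_extended (square_invariant σ hc.tail).origin hc.time_le]
    rw [firstRequests_succ (by omega)]
    simp only [square]
    rw [mem_replicas_serve hx, Set.mem_ofPred_eq]
    simp only [serve, or_assoc]

theorem totalRadius_eq_sum (h : Arrivals o L) :
    totalRadius o σ L = ∑ i ∈ Finset.range L.length, (squareRun σ h).ρ i := by
  have key : ∀ k ≤ L.length, totalRadius o σ (firstRequests L k) =
      ∑ i ∈ Finset.range k, (squareRun σ h).ρ i := by
    intro k hk
    induction k with
    | zero => simp [firstRequests_zero, totalRadius]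
    | succ k ih =>
      rw [Finset.sum_range_succ, ← ih (by omega), firstRequests_succ hk]
      rfl
  rw [← key _ le_rfl, firstRequests_length]

/-- Square is competitive: the path of a solution to a request has its last `ρ` edges in the box of
the request. -/
theorem totalRadius_le_four_mul_card (h : Arrivals o L) {F : Finset Edge}
    (hF : ∀ e ∈ F, IsHorizontal e ∨ IsArc e) (hr : ∀ r ∈ L, Reaches F (o, 0) r) :
    totalRadius o σ L ≤ 4 * F.card := by
  rw [totalRadius_eq_sum σ h]
  refine (squareRun σ h).sum_radius_le fun i hi => ?_
  refine (hr _ (requestAt_mem hi)).le_card_box hF ?_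
  have hc := h.requestAt_cons hi
  have ho := h.2 _ (requestAt_mem hi)
  have := SquareState.radius_far ho
    ((square_invariant σ hc.tail).origin_extended hc.time_le)
    ((square_invariant σ hc.tail).origin_extended hc.time_le) ho le_rfl
  simp only [squareRun] at this ⊢
  omega

end SquareRun

/-! ### Histories and online algorithms -/

theorem History.Valid.of_cons {n o : ℕ} {e : Event} {h : History}
    (hv : History.Valid n o (e :: h)) : h.Valid n o :=
  fun v hm => hv v (List.mem_cons_of_mem _ hm)

theorem History.time_le_of_mem_requests {h : History} {r : Replica} (hr : r ∈ h.requests) :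
    r.2 ≤ h.time := by
  induction h with
  | nil => simp [History.requests] at hr
  | cons e h ih =>
    cases e with
    | request v =>
      rcases List.mem_cons.1 hr with rfl | hr
      · exact le_rfl
      · exact ih hr
    | tick => exact (ih hr).trans (Nat.le_succ _)

theorem History.Valid.arrivals {n o : ℕ} {h : History} (hv : h.Valid n o) :
    Arrivals o h.requests := by
  induction h with
  | nil => exact ⟨List.Pairwise.nil, by simp [History.requests]⟩
  | cons e h ih =>
    have ih := ih hv.of_cons
    cases e with
    | request v =>
      refine ⟨List.pairwise_cons.2 ⟨fun r hr => History.time_le_of_mem_requests hr, ih.1⟩, ?_⟩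
      intro r hr
      rcases List.mem_cons.1 hr with rfl | hr
      · exact (hv v List.mem_cons_self).1
      · exact ih.2 r hr
    | tick => exact ih

theorem History.square_time_le {o : ℕ} (σ : Selector (List Replica)) (h : History) :
    (square o σ h.requests).time ≤ h.time := by
  cases hl : h.requests with
  | nil => exact Nat.zero_le _
  | cons r L =>
    exact History.time_le_of_mem_requests (by rw [hl]; exact List.mem_cons_self)

theorem History.requests_tick (h : History) :
    History.requests (Event.tick :: h) = h.requests := rfl

theorem History.requests_request (v : ℕ) (h : History) :
    History.requests (Event.request v :: h) = (v, h.time) :: h.requests := rfl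

theorem History.time_map_append (vs : List ℕ) (h : History) :
    History.time (vs.map Event.request ++ h) = h.time := by
  induction vs with
  | nil => rfl
  | cons v vs ih => exact ih

theorem History.requests_map_append (vs : List ℕ) (h : History) :
    History.requests (vs.map Event.request ++ h) =
      vs.map (fun v => (v, h.time)) ++ h.requests := by
  induction vs with
  | nil => rfl
  | cons v vs ih =>
    change (v, History.time (vs.map Event.request ++ h)) ::
      History.requests (vs.map Event.request ++ h) = _
    rw [ih, History.time_map_append]
    rfl

theorem historyUpTo_succ (R : List Replica) (t : ℕ) : historyUpTo R (t + 1) = Event.tick ::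
    (((R.filter fun r => r.2 = t).map Prod.fst).reverse.map Event.request ++ historyUpTo R t) := by
  rw [historyUpTo, ← List.map_reverse, ← List.map_reverse, List.map_map]
  rfl

theorem time_historyUpTo (R : List Replica) (t : ℕ) : (historyUpTo R t).time = t := by
  induction t with
  | zero => rfl
  | succ t ih =>
    rw [historyUpTo_succ]
    change History.time _ + 1 = _
    rw [History.time_map_append, ih]

theorem filter_lt_succ_of_sorted {R : List Replica} (h : R.Pairwise fun r r' => r.2 ≤ r'.2)
    (t : ℕ) : (R.filter fun r => r.2 < t + 1) =
      (R.filter fun r => r.2 < t) ++ R.filter fun r => r.2 = t := by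
  induction R with
  | nil => rfl
  | cons r R ih =>
    rw [List.pairwise_cons] at h
    have ih := ih h.2
    rcases lt_trichotomy r.2 t with hr | hr | hr
    · rw [List.filter_cons_of_pos (by simp; omega), List.filter_cons_of_pos (by simp; omega),
        List.filter_cons_of_neg (by simp; omega), ih]
      rfl
    · have h0 : (R.filter fun r => r.2 < t) = [] := by
        rw [List.filter_eq_nil_iff]
        intro a ha
        have := h.1 a ha
        simp; omega
      rw [List.filter_cons_of_pos (by simp; omega), List.filter_cons_of_neg (by simp; omega),
        List.filter_cons_of_pos (by simp; omega), ih, h0]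
      rfl
    · rw [List.filter_cons_of_neg (by simp; omega), List.filter_cons_of_neg (by simp; omega),
        List.filter_cons_of_neg (by simp; omega), ih]

theorem requests_historyUpTo {R : List Replica} (h : R.Pairwise fun r r' => r.2 ≤ r'.2) (t : ℕ) :
    (historyUpTo R t).requests = (R.filter fun r => r.2 < t).reverse := by
  induction t with
  | zero => simp [historyUpTo, History.requests]
  | succ t ih =>
    rw [historyUpTo_succ, filter_lt_succ_of_sorted h, List.reverse_append, ← ih]
    rw [History.requests_tick, History.requests_map_append, time_historyUpTo, ← List.map_reverse,
      List.map_map]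
    congr 1
    refine (List.map_congr_left fun r hr => ?_).trans (List.map_id _)
    rw [List.mem_reverse, List.mem_filter, decide_eq_true_eq] at hr
    exact Prod.ext rfl hr.2.symm

theorem le_lastTime {R : List Replica} {r : Replica} (hr : r ∈ R) : r.2 ≤ lastTime R := by
  induction R with
  | nil => simp at hr
  | cons r' R ih =>
    simp only [lastTime, List.map_cons, List.foldr_cons] at ih ⊢
    rcases List.mem_cons.1 hr with rfl | hr
    · exact le_max_left _ _
    · exact (ih hr).trans (le_max_right _ _)

theorem exists_eq_lastTime {R : List Replica} (hR : R ≠ []) : ∃ r ∈ R, r.2 = lastTime R := by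
  induction R with
  | nil => exact absurd rfl hR
  | cons r' R ih =>
    simp only [lastTime, List.map_cons, List.foldr_cons] at ih ⊢
    by_cases h : R = []
    · subst h; exact ⟨r', by simp, by simp⟩
    · obtain ⟨r, hr, he⟩ := ih h
      rcases le_total r'.2 (R.map Prod.snd |>.foldr max 0) with h1 | h1
      · exact ⟨r, List.mem_cons_of_mem _ hr, by rw [max_eq_right h1, he]⟩
      · exact ⟨r', List.mem_cons_self, by rw [max_eq_left h1]⟩

theorem requests_historyUpTo_lastTime {R : List Replica}
    (h : R.Pairwise fun r r' => r.2 ≤ r'.2) :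
    (historyUpTo R (lastTime R + 1)).requests = R.reverse := by
  rw [requests_historyUpTo h, List.filter_eq_self.2]
  intro r hr
  have := le_lastTime hr
  simp; omega

theorem valid_historyUpTo {n o : ℕ} {R : List Replica} (h : IsInstance n o R) (t : ℕ) :
    (historyUpTo R t).Valid n o := by
  induction t with
  | zero => intro v hv; simp [historyUpTo] at hv
  | succ t ih =>
    intro v hv
    rw [historyUpTo_succ] at hv
    simp only [List.mem_cons, reduceCtorEq, false_or, List.mem_append, List.mem_map,
      List.mem_reverse, List.mem_filter] at hv
    rcases hv with ⟨w, ⟨r, ⟨hr, -⟩, rfl⟩, hw⟩ | hv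
    · cases hw
      exact h.2 r hr
    · exact ih v hv

theorem le_of_mem_replicas {n o : ℕ} (ho : o ≤ n) {F : Finset Edge}
    (hF : ∀ e ∈ F, e ∈ gridEdges n) {p : Replica} (hp : p ∈ replicas o F) : p.1 ≤ n := by
  obtain rfl | ⟨e, he, rfl | rfl⟩ := mem_replicas.1 hp
  exacts [ho, (hF e he).2.1, (hF e he).2.2]

/-- The rules of the online problem guarantee that all replicas are connected to the origin. -/
theorem IsOnline.feasible_history {n o : ℕ} {A : Algorithm} (hA : IsOnline n o A) (ho : o ≤ n)
    {h : History} (hv : h.Valid n o) : (∀ e ∈ A h, e ∈ gridEdges n) ∧ ReachesAll o (A h) ∧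
      ∀ r ∈ h.requests, r ∈ replicas o (A h) := by
  induction h with
  | nil =>
    rw [hA.1]
    exact ⟨by simp, reachesAll_empty o, by simp [History.requests]⟩
  | cons e h ih =>
    obtain ⟨ih1, ih2, ih3⟩ := ih hv.of_cons
    obtain ⟨hreq, hS⟩ := hA.2 h hv.of_cons
    cases e with
    | request v =>
      have hvn := hv v List.mem_cons_self
      obtain ⟨w, hwv, hw, heq⟩ := hreq v hvn.1 hvn.2
      rw [heq]
      refine ⟨fun e he => ?_, ih2.union_horPath hw, fun r hr => ?_⟩
      · rcases Finset.mem_union.1 he with he | he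
        · exact ih1 e he
        · obtain ⟨x, h1, h2, rfl⟩ := mem_horPath.1 he
          exact ⟨Or.inl rfl, by simp only; omega, by simp only; omega⟩
      · rw [mem_replicas_union]
        rcases List.mem_cons.1 hr with rfl | hr
        · rcases hwv.eq_or_lt with rfl | hwv
          · exact Or.inl hw
          · exact Or.inr (exists_mem_horPath.2 ⟨hwv, hwv.le, le_rfl, rfl⟩)
        · exact Or.inl (ih3 r hr)
    | tick =>
      obtain ⟨S, -, hS, heq⟩ := hS
      rw [heq]
      have hmem : ∀ e ∈ S.image fun w => ((w, History.time h), (w, History.time h + 1)),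
          ∃ w, (w, History.time h) ∈ replicas o (A h) ∧
            e = ((w, History.time h), (w, History.time h + 1)) := by
        intro e he
        obtain ⟨w, hw, rfl⟩ := Finset.mem_image.1 he
        exact ⟨w, hS w hw, rfl⟩
      refine ⟨fun e he => ?_, ih2.union fun e he => ?_, fun r hr => ?_⟩
      · rcases Finset.mem_union.1 he with he | he
        · exact ih1 e he
        · obtain ⟨w, hw, rfl⟩ := hmem e he
          have := le_of_mem_replicas ho ih1 hw
          exact ⟨Or.inr rfl, this, this⟩
      · obtain ⟨w, hw, rfl⟩ := hmem e he
        exact (ih2 _ hw).mono Finset.subset_union_left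
      · exact mem_replicas_union.2 (Or.inl (ih3 r hr))

theorem IsOnline.feasible {n o : ℕ} {A : Algorithm} (hA : IsOnline n o A) (ho : o ≤ n)
    {R : List Replica} (hR : IsInstance n o R) : Feasible n o R (A.solution R) := by
  obtain ⟨h1, h2, h3⟩ := hA.feasible_history ho (valid_historyUpTo hR (lastTime R + 1))
  rw [requests_historyUpTo_lastTime hR.1] at h3
  exact ⟨h1, fun r hr => h2 r (h3 r (List.mem_reverse.2 hr))⟩

/-! ### Neighborhoods and the storage phase -/

/-- The neighborhood of `v` starts at the beginning of the block of `δ ^ l` nodes before the one of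
`v`; the node `0` takes the place of the block before the first. -/
theorem mem_neighborhood {n δ l v u : ℕ} (hδ : 0 < δ) (h1 : 1 ≤ v) (hn : v ≤ n) :
    u ∈ neighborhood n δ l v ↔ u ≤ v ∧ (v - 1) / δ ^ l * δ ^ l < u + δ ^ l := by
  have hd : 0 < δ ^ l := pow_pos hδ l
  have hlt := Nat.lt_div_mul_add hd (a := v - 1)
  have hle := Nat.div_mul_le_self (v - 1) (δ ^ l)
  rw [neighborhood, Finset.mem_filter, Finset.mem_union, leftNeighbor, intervalIndex, interval,
    interval]
  generalize (v - 1) / δ ^ l = q at *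
  generalize δ ^ l = d at *
  rcases q with _ | q
  · simp only [zero_add, if_true, Finset.mem_singleton, Finset.mem_filter, Finset.mem_Icc]
    simp only [zero_mul, one_mul, Nat.sub_self, zero_add] at *
    omega
  · rw [if_neg (by omega)]
    simp only [Finset.mem_filter, Finset.mem_Icc, Nat.add_sub_cancel, add_mul, one_mul] at *
    omega

/-- The two outcomes of a selection step, provided that the selector has a candidate to choose. -/
theorem select_cases {n δ : ℕ} {τ : Selector (History × ℕ × ℕ)} {h : History} {s : SquareState}
    {copies : Finset ℕ} {l v : ℕ} {C : Finset ℕ}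
    (hne : StayActive δ l v (History.time h) (s.base ∪ s.tail) → C ∩ neighborhood n δ l v = ∅ →
      ∃ u ∈ neighborhood n δ l v, u ∈ copies ∨ (u, History.time h) ∈ s.base) :
    (select n δ τ h s copies l v C = C ∧
      ¬ (StayActive δ l v (History.time h) (s.base ∪ s.tail) ∧ C ∩ neighborhood n δ l v = ∅)) ∨
    ((StayActive δ l v (History.time h) (s.base ∪ s.tail) ∧ C ∩ neighborhood n δ l v = ∅) ∧
      ∃ u ∈ neighborhood n δ l v, (u ∈ copies ∨ (u, History.time h) ∈ s.base) ∧
        select n δ τ h s copies l v C = insert u C) := by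
  unfold select
  split_ifs with hc
  · right
    obtain ⟨u, hu, hu'⟩ := hne hc.1 hc.2
    have := τ.pick_mem (h, l, v) ((neighborhood n δ l v).filter
      fun u => u ∈ copies ∨ (u, History.time h) ∈ s.base) ⟨u, Finset.mem_filter.2 ⟨hu, hu'⟩⟩
    rw [Finset.mem_filter] at this
    exact ⟨hc, _, this.1, this.2, rfl⟩
  · exact Or.inl ⟨rfl, hc⟩

theorem subset_select {n δ : ℕ} {τ : Selector (History × ℕ × ℕ)} {h : History} {s : SquareState}
    {copies : Finset ℕ} {l v : ℕ} {C : Finset ℕ} : C ⊆ select n δ τ h s copies l v C := by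
  unfold select
  split_ifs
  · exact Finset.subset_insert _ _
  · exact subset_rfl

theorem foldl_induction {α β : Type*} (P : β → Prop) (f : β → α → β) (L : List α) (b : β)
    (hb : P b) (hf : ∀ b, ∀ a ∈ L, P b → P (f b a)) : P (L.foldl f b) := by
  induction L generalizing b with
  | nil => exact hb
  | cons a L ih =>
    exact ih (f b a) (hf b a List.mem_cons_self hb) fun b a' ha =>
      hf b a' (List.mem_cons_of_mem _ ha)

/-- If the step at `a` establishes `G` from `P`, and all steps preserve both, then `G` holds at the
end of the fold. -/
theorem foldl_establishes {α β : Type*} (P G : β → Prop) (f : β → α → β) (L : List α) (b : β)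
    {a : α} (ha : a ∈ L) (hb : P b) (hf : ∀ b, ∀ a ∈ L, P b → P (f b a))
    (hG : ∀ b, P b → G (f b a)) (hG' : ∀ b, ∀ a ∈ L, P b → G b → G (f b a)) :
    G (L.foldl f b) := by
  induction L generalizing b with
  | nil => simp at ha
  | cons a' L ih =>
    have hf' : ∀ b, ∀ a ∈ L, P b → P (f b a) := fun b a ha => hf b a (List.mem_cons_of_mem _ ha)
    have hG'' : ∀ b, ∀ a ∈ L, P b → G b → G (f b a) :=
      fun b a ha => hG' b a (List.mem_cons_of_mem _ ha)
    have hP := hf b a' List.mem_cons_self hb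
    rcases List.mem_cons.1 ha with rfl | ha
    · exact (foldl_induction (fun b => P b ∧ G b) f L _ ⟨hP, hG b hb⟩
        fun b a ha h => ⟨hf' b a ha h.1, hG'' b a ha h.1 h.2⟩).2
    · exact ih _ ha hP hf' hG''

theorem subset_foldl_select {n δ : ℕ} {τ : Selector (History × ℕ × ℕ)} {h : History}
    {s : SquareState} {copies : Finset ℕ} {l : ℕ} {C : Finset ℕ} :
    C ⊆ (List.range' 1 n).foldl (fun C v => select n δ τ h s copies l v C) C :=
  foldl_induction (fun C' => C ⊆ C') _ _ _ subset_rfl fun _ _ _ hC' => hC'.trans subset_select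

section NextCopies

variable {n o δ : ℕ} {τ : Selector (History × ℕ × ℕ)} {h : History} {s : SquareState}
  {copies : Finset ℕ}

/-- The copies with which the storage phase starts: the origin and the current tails. -/
def tailCopies (o : ℕ) (h : History) (s : SquareState) : Finset ℕ :=
  insert o ((s.tail.filter fun p => p.2 = History.time h).image Prod.fst)

/-- Whenever the storage phase has to select a copy near `v`, there is a candidate: the phase can be
carried out without falling back on an arbitrary value of the selector. -/
def HasCandidates (n o δ : ℕ) (h : History) (s : SquareState) (copies : Finset ℕ) : Prop :=
  ∀ l ≤ Nat.clog δ n, ∀ v, 1 ≤ v → v ≤ n → ∀ C, tailCopies o h s ⊆ C →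
    StayActive δ l v (History.time h) (s.base ∪ s.tail) → C ∩ neighborhood n δ l v = ∅ →
      ∃ u ∈ neighborhood n δ l v, u ∈ copies ∨ (u, History.time h) ∈ s.base

theorem nextCopies_induction (P : Finset ℕ → Prop) (h0 : P (tailCopies o h s))
    (hstep : ∀ l ≤ Nat.clog δ n, ∀ v, 1 ≤ v → v ≤ n → ∀ C, P C →
      P (select n δ τ h s copies l v C)) :
    P (nextCopies n o δ τ h s copies) := by
  refine foldl_induction P _ _ _ h0 fun C l hl hC => foldl_induction P _ _ _ hC fun C v hv hC => ?_
  rw [List.mem_range] at hl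
  rw [List.mem_range'_1] at hv
  exact hstep l (by omega) v (by omega) (by omega) C hC

theorem tailCopies_subset_nextCopies : tailCopies o h s ⊆ nextCopies n o δ τ h s copies :=
  nextCopies_induction (fun C => tailCopies o h s ⊆ C) subset_rfl
    fun _ _ _ _ _ _ hC => hC.trans subset_select

theorem nextCopies_mem (hcand : HasCandidates n o δ h s copies) {w : ℕ}
    (hw : w ∈ nextCopies n o δ τ h s copies) :
    w ∈ tailCopies o h s ∨ w ∈ copies ∨ (w, History.time h) ∈ s.base := by
  refine (nextCopies_induction (fun C => tailCopies o h s ⊆ C ∧ ∀ w ∈ C, w ∈ tailCopies o h s ∨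
    w ∈ copies ∨ (w, History.time h) ∈ s.base) ⟨subset_rfl, fun w hw => Or.inl hw⟩ ?_).2 w hw
  intro l hl v h1 hn C ⟨hC, hC'⟩
  refine ⟨hC.trans subset_select, ?_⟩
  rcases select_cases (hcand l hl v h1 hn C hC) (τ := τ) with ⟨heq, -⟩ | ⟨-, u, -, hu, heq⟩
  · rw [heq]; exact hC'
  · rw [heq]
    intro w hw
    rcases Finset.mem_insert.1 hw with rfl | hw
    · exact Or.inr hu
    · exact hC' w hw

theorem nextCopies_inter_nonempty (hcand : HasCandidates n o δ h s copies) {l v : ℕ}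
    (hl : l ≤ Nat.clog δ n) (h1 : 1 ≤ v) (hn : v ≤ n)
    (hact : StayActive δ l v (History.time h) (s.base ∪ s.tail)) :
    (nextCopies n o δ τ h s copies ∩ neighborhood n δ l v).Nonempty := by
  have hmono : ∀ {C C' : Finset ℕ}, C ⊆ C' → (C ∩ neighborhood n δ l v).Nonempty →
      (C' ∩ neighborhood n δ l v).Nonempty := fun hs hne =>
    hne.mono (Finset.inter_subset_inter_right hs)
  refine foldl_establishes (fun C => tailCopies o h s ⊆ C)
    (fun C => (C ∩ neighborhood n δ l v).Nonempty) _ _ _ (a := l)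
    (List.mem_range.2 (by omega)) subset_rfl (fun C l' _ hC => hC.trans subset_foldl_select)
    (fun C hC => ?_) (fun C l' _ _ hne => hmono subset_foldl_select hne)
  refine foldl_establishes (fun C => tailCopies o h s ⊆ C)
    (fun C => (C ∩ neighborhood n δ l v).Nonempty) _ _ _ (a := v)
    (by rw [List.mem_range'_1]; omega) hC (fun C v' _ hC => hC.trans subset_select)
    (fun C hC => ?_) (fun C v' _ _ hne => hmono subset_select hne)
  rcases select_cases (hcand l hl v h1 hn C hC) (τ := τ) with ⟨heq, hnot⟩ | ⟨-, u, hu, -, heq⟩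
  · rw [heq, Finset.nonempty_iff_ne_empty]
    exact fun he => hnot ⟨hact, he⟩
  · rw [heq]
    exact ⟨u, Finset.mem_inter.2 ⟨Finset.mem_insert_self _ _, hu⟩⟩

/-- On one level at most one node is selected for each interval: a selection for a node of the
interval also serves the later nodes of this interval. The set `D` contains the (shifted) indices
of all intervals for which a selection is made. -/
theorem card_foldl_select_le (hδ : 0 < δ) (hcand : HasCandidates n o δ h s copies) {l : ℕ}
    (hl : l ≤ Nat.clog δ n) {D : Finset ℕ}
    (hD : ∀ v, 1 ≤ v → v ≤ n → ∀ C, tailCopies o h s ⊆ C →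
      StayActive δ l v (History.time h) (s.base ∪ s.tail) → C ∩ neighborhood n δ l v = ∅ →
      (v - 1) / δ ^ l ∈ D) {C : Finset ℕ} (hC : tailCopies o h s ⊆ C) :
    ((List.range' 1 n).foldl (fun C v => select n δ τ h s copies l v C) C).card ≤
      C.card + D.card := by
  have key : ∀ m ≤ n, ∃ S ⊆ D,
      tailCopies o h s ⊆ (List.range' 1 m).foldl (fun C v => select n δ τ h s copies l v C) C ∧
      ((List.range' 1 m).foldl (fun C v => select n δ τ h s copies l v C) C).card ≤
        C.card + S.card ∧
      ∀ q ∈ S, ∃ v, 1 ≤ v ∧ v ≤ m ∧ (v - 1) / δ ^ l = q ∧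
        ((List.range' 1 m).foldl (fun C v => select n δ τ h s copies l v C) C ∩
          neighborhood n δ l v).Nonempty := by
    intro m hm
    induction m with
    | zero => exact ⟨∅, Finset.empty_subset _, hC, by simp, by simp⟩
    | succ m ih =>
      obtain ⟨S, hSD, hsub, hcard, hS⟩ := ih (by omega)
      rw [List.range'_1_concat, List.foldl_append, List.foldl_cons, List.foldl_nil, add_comm 1 m]
      generalize (List.range' 1 m).foldl (fun C v => select n δ τ h s copies l v C) C = C' at *
      rcases select_cases (hcand l hl (m + 1) (by omega) hm C' hsub) (τ := τ) with
        ⟨heq, -⟩ | ⟨⟨ha, he⟩, u, hu, -, heq⟩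
      · rw [heq]
        refine ⟨S, hSD, hsub, hcard, fun q hq => ?_⟩
        obtain ⟨v, hv1, hv2, hv3⟩ := hS q hq
        exact ⟨v, hv1, by omega, hv3⟩
      · rw [heq]
        have hq : (m + 1 - 1) / δ ^ l ∉ S := by
          intro hq
          obtain ⟨v, hv1, hv2, hv3, w, hw⟩ := hS _ hq
          rw [Finset.mem_inter, mem_neighborhood hδ hv1 (by omega), hv3] at hw
          have : w ∈ C' ∩ neighborhood n δ l (m + 1) := by
            rw [Finset.mem_inter, mem_neighborhood hδ (by omega) hm]
            exact ⟨hw.1, by omega, hw.2.2⟩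
          rw [he] at this
          simp at this
        refine ⟨insert ((m + 1 - 1) / δ ^ l) S, Finset.insert_subset
          (hD (m + 1) (by omega) hm C' hsub ha he) hSD, hsub.trans (Finset.subset_insert _ _), ?_,
          fun q hq' => ?_⟩
        · rw [Finset.card_insert_of_notMem hq]
          have := Finset.card_insert_le u C'
          omega
        · rcases Finset.mem_insert.1 hq' with rfl | hq'
          · exact ⟨m + 1, by omega, le_rfl, rfl, u, Finset.mem_inter.2
              ⟨Finset.mem_insert_self _ _, hu⟩⟩
          · obtain ⟨v, hv1, hv2, hv3, hv4⟩ := hS q hq'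
            exact ⟨v, hv1, by omega, hv3, hv4.mono
              (Finset.inter_subset_inter_right (Finset.subset_insert _ _))⟩
  obtain ⟨S, hSD, -, hcard, -⟩ := key n le_rfl
  have := Finset.card_le_card hSD
  omega

theorem card_nextCopies_le (hδ : 0 < δ) (hcand : HasCandidates n o δ h s copies)
    (D : ℕ → Finset ℕ)
    (hD : ∀ l ≤ Nat.clog δ n, ∀ v, 1 ≤ v → v ≤ n → ∀ C, tailCopies o h s ⊆ C →
      StayActive δ l v (History.time h) (s.base ∪ s.tail) → C ∩ neighborhood n δ l v = ∅ →
      (v - 1) / δ ^ l ∈ D l) :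
    (nextCopies n o δ τ h s copies).card ≤ (tailCopies o h s).card +
      ∑ l ∈ Finset.range (Nat.clog δ n + 1), (D l).card := by
  have key : ∀ m ≤ Nat.clog δ n + 1,
      tailCopies o h s ⊆ (List.range m).foldl (fun C l => (List.range' 1 n).foldl
        (fun C v => select n δ τ h s copies l v C) C) (tailCopies o h s) ∧
      ((List.range m).foldl (fun C l => (List.range' 1 n).foldl
        (fun C v => select n δ τ h s copies l v C) C) (tailCopies o h s)).card ≤
        (tailCopies o h s).card + ∑ l ∈ Finset.range m, (D l).card := by
    intro m hm
    induction m with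
    | zero => exact ⟨subset_rfl, by simp⟩
    | succ m ih =>
      obtain ⟨ih1, ih2⟩ := ih (by omega)
      rw [List.range_succ, List.foldl_append, List.foldl_cons, List.foldl_nil,
        Finset.sum_range_succ]
      refine ⟨ih1.trans subset_foldl_select, ?_⟩
      have := card_foldl_select_le (τ := τ) hδ hcand (by omega) (hD m (by omega)) ih1
      omega
  exact (key _ le_rfl).2

end NextCopies

/-! ### The invariants of the online algorithm -/

/-- The invariants of the online algorithm at the current time: `copies` are replicas of the
solution, Base and Tail of Square are available at the current time, and near every node that was
stay-active at the previous clock event there is a copy. -/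
structure OnlineInvariant (n o δ : ℕ) (h : History) (s : SquareState) (st : OnlineState) :
    Prop where
  copies_sub : ∀ w ∈ st.copies, (w, History.time h) ∈ replicas o st.sol
  origin_mem : o ∈ st.copies
  base_now : ∀ w, (w, History.time h) ∈ s.base → (w, History.time h) ∈ replicas o st.sol
  tail_now : ∀ w, (w, History.time h) ∈ s.tail → w ∈ st.copies ∨ (w, History.time h) ∈ s.base
  active : ∀ l ≤ Nat.clog δ n, ∀ v, 1 ≤ v → v ≤ n → ∀ p ∈ s.base ∪ s.tail, p.1 = v →
    p.2 < History.time h → History.time h ≤ p.2 + δ ^ l →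
    (st.copies ∩ neighborhood n δ l v).Nonempty

section Online

variable {n o δ : ℕ} {σ : Selector (List Replica)} {τ : Selector (History × ℕ × ℕ)}
  {h : History} {s : SquareState} {st : OnlineState}

theorem OnlineInvariant.hasCandidates (hδ : 0 < δ) (hi : OnlineInvariant n o δ h s st) :
    HasCandidates n o δ h s st.copies := by
  intro l hl v h1 hn C hC ⟨p, hp, hpv, hpt, hpt'⟩ he
  have hself : v ∈ neighborhood n δ l v := by
    rw [mem_neighborhood hδ h1 hn]
    have := Nat.div_mul_le_self (v - 1) (δ ^ l)
    omega
  rcases hpt.eq_or_lt with heq | hlt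
  · have hpe : p = (v, History.time h) := Prod.ext hpv heq
    rw [hpe, Finset.mem_union] at hp
    rcases hp with hp | hp
    · exact ⟨v, hself, Or.inr hp⟩
    · refine absurd he (Finset.nonempty_iff_ne_empty.1 ⟨v, Finset.mem_inter.2 ⟨hC ?_, hself⟩⟩)
      exact Finset.mem_insert_of_mem (Finset.mem_image.2
        ⟨_, Finset.mem_filter.2 ⟨hp, rfl⟩, rfl⟩)
  · obtain ⟨u, hu⟩ := hi.active l hl v h1 hn p hp hpv hlt hpt'.le
    rw [Finset.mem_inter] at hu
    exact ⟨u, hu.2, Or.inl hu.1⟩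

theorem OnlineInvariant.nextCopies_sub (hδ : 0 < δ) (hi : OnlineInvariant n o δ h s st) {w : ℕ}
    (hw : w ∈ nextCopies n o δ τ h s st.copies) : (w, History.time h) ∈ replicas o st.sol := by
  rcases nextCopies_mem (hi.hasCandidates hδ) hw with hw | hw | hw
  · rcases Finset.mem_insert.1 hw with rfl | hw
    · exact hi.copies_sub _ hi.origin_mem
    · obtain ⟨⟨a, b⟩, hp, rfl⟩ := Finset.mem_image.1 hw
      obtain ⟨hp, rfl⟩ := Finset.mem_filter.1 hp
      rcases hi.tail_now a hp with hw | hw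
      · exact hi.copies_sub _ hw
      · exact hi.base_now _ hw
  · exact hi.copies_sub _ hw
  · exact hi.base_now _ hw

/-- The supremum in the delivery step is attained: the source of a delivery is the closest replica
to the left of the serving node. -/
theorem exists_delivery_source {u t : ℕ} (v : ℕ) (hou : o ≤ u) (ho : (o, t) ∈ replicas o st.sol) :
    ∃ w ≤ u, (w, t) ∈ replicas o st.sol ∧
      (∀ x ≤ u, (x, t) ∈ replicas o st.sol → x ≤ w) ∧
      st.deliver o u v t = { st with sol := st.sol ∪ horPath w v t } := by
  have hne : ((replicas o st.sol).filter fun p => p.2 = t ∧ p.1 ≤ u).Nonempty :=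
    ⟨_, Finset.mem_filter.2 ⟨ho, rfl, hou⟩⟩
  obtain ⟨⟨a, b⟩, hp, heq⟩ := Finset.exists_mem_eq_sup _ hne Prod.fst
  obtain ⟨hp', hpt, hpu⟩ := Finset.mem_filter.1 hp
  obtain rfl : b = t := hpt
  refine ⟨a, hpu, hp', fun x hx hx' => ?_, ?_⟩
  · have hm : (x, b) ∈ (replicas o st.sol).filter fun p => p.2 = b ∧ p.1 ≤ u :=
      Finset.mem_filter.2 ⟨hx', rfl, hx⟩
    exact (Finset.le_sup (f := Prod.fst) hm).trans heq.le
  · rw [OnlineState.deliver, heq]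

theorem onlineRun_invariant (hδ : 0 < δ) (hv : h.Valid n o) :
    OnlineInvariant n o δ h (square o σ h.requests) (onlineRun n o δ σ τ h) := by
  induction h with
  | nil =>
    constructor <;>
      simp [onlineRun, square, History.requests, History.time, replicas]
  | cons e h ih =>
    have hi := ih hv.of_cons
    have harr := History.Valid.arrivals hv
    cases e with
    | request v =>
      rw [History.requests_request] at harr ⊢
      have hs := square_invariant σ harr.tail
      obtain ⟨hou, huv, -⟩ := hs.servingNode_mem harr.time_le (harr.2 _ List.mem_cons_self)
      obtain ⟨w, hwu, hw, -, heq⟩ := exists_delivery_source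
        (st := onlineRun n o δ σ τ h) v hou (hi.copies_sub _ hi.origin_mem)
      have hrun : onlineRun n o δ σ τ (Event.request v :: h) = _ := heq
      have hT : History.time (Event.request v :: h) = History.time h := rfl
      rw [hrun, square]
      simp only at huv hwu
      have hsub : ∀ p ∈ replicas o (onlineRun n o δ σ τ h).sol,
          p ∈ replicas o ((onlineRun n o δ σ τ h).sol ∪ horPath w v (History.time h)) :=
        fun p hp => mem_replicas_union.2 (Or.inl hp)
      refine ⟨fun x hx => ?_, hi.origin_mem, fun x hx => ?_, fun x hx => ?_, ?_⟩
      · exact hsub _ (hi.copies_sub x hx)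
      · rw [hT] at hx ⊢
        rcases SquareState.mem_base_serve.1 hx with hx | ⟨-, hx1, hx2⟩
        · exact hsub _ (hi.base_now x hx)
        · simp only at hx1 hx2
          rcases (show w ≤ v by omega).eq_or_lt with rfl | hwv
          · obtain rfl : x = w := by omega
            exact hsub _ hw
          · exact mem_replicas_union.2 (Or.inr (exists_mem_horPath.2
              ⟨hwv, by simp only; omega, hx2, rfl⟩))
      · rw [hT] at hx ⊢
        rw [SquareState.mem_base_serve]
        rcases SquareState.mem_tail_serve.1 hx with hx | ⟨hx1, -⟩
        · exact (hi.tail_now x hx).imp_right Or.inl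
        · exact Or.inr (Or.inr ⟨rfl, by simp only at *; omega, by simp only at *; omega⟩)
      · intro l hl x h1 hn p hp hpx hpt hpt'
        rw [hT] at hpt hpt'
        refine hi.active l hl x h1 hn p ?_ hpx hpt hpt'
        rw [Finset.mem_union, SquareState.mem_base_serve, SquareState.mem_tail_serve] at hp
        simp only at hp
        rw [Finset.mem_union]
        rcases hp with (hp | hp) | (hp | hp)
        · exact Or.inl hp
        · omega
        · exact Or.inr hp
        · omega
    | tick =>
      rw [History.requests_tick] at harr ⊢
      have hs := square_invariant σ harr
      have htime := History.square_time_le (o := o) σ h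
      have hT : History.time (Event.tick :: h) = History.time h + 1 := rfl
      rw [onlineRun]
      have hcand := hi.hasCandidates hδ
      refine ⟨fun x hx => ?_, ?_, fun x hx => ?_, fun x hx => Or.inl ?_, ?_⟩
      · exact mem_replicas_union.2 (Or.inr ⟨_, Finset.mem_image_of_mem _ hx, Or.inr rfl⟩)
      · exact tailCopies_subset_nextCopies (Finset.mem_insert_self _ _)
      · have := hs.base_time _ hx
        rw [hT] at this
        simp only at this
        omega
      · rw [hT] at hx
        obtain ⟨b, hb1, hb2, hb3⟩ := hs.born _ hx
        refine tailCopies_subset_nextCopies (Finset.mem_insert_of_mem (Finset.mem_image.2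
          ⟨_, Finset.mem_filter.2 ⟨hb3 (History.time h) (by omega) (by simp), rfl⟩, rfl⟩))
      · intro l hl x h1 hn p hp hpx hpt hpt'
        exact nextCopies_inter_nonempty hcand hl h1 hn
          ⟨p, hp, hpx, by omega, by omega⟩

theorem dlineOn_isOnline (hδ : 0 < δ) : IsOnline n o (dlineOn n o δ σ τ) := by
  refine ⟨rfl, fun h hv => ⟨fun v hov hvn => ?_, ?_⟩⟩
  · have hi := onlineRun_invariant (σ := σ) (τ := τ) hδ hv
    have hv' : History.Valid n o (Event.request v :: h) := fun x hx => by
      rcases List.mem_cons.1 hx with hx | hx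
      · cases hx; exact ⟨hov, hvn⟩
      · exact hv x hx
    have harr := History.Valid.arrivals hv'
    rw [History.requests_request] at harr
    obtain ⟨hou, huv, -⟩ := (square_invariant σ harr.tail).servingNode_mem harr.time_le hov
    obtain ⟨w, hwu, hw, -, heq⟩ := exists_delivery_source
      (st := onlineRun n o δ σ τ h) v hou (hi.copies_sub _ hi.origin_mem)
    exact ⟨w, hwu.trans huv, hw, congrArg OnlineState.sol heq⟩
  · have hi := onlineRun_invariant (σ := σ) (τ := τ) hδ hv
    exact ⟨nextCopies n o δ τ h (square o σ h.requests) (onlineRun n o δ σ τ h).copies,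
      ⟨o, tailCopies_subset_nextCopies (Finset.mem_insert_self _ _)⟩,
      fun w hw => hi.nextCopies_sub hδ hw, rfl⟩

/-! ### The delivery cost -/

/-- A delivery costs at most `15 δ ρ`. Square has a replica at the serving node at most `5ρ` time
units ago; on the lowest level `l` with `5ρ ≤ δ ^ l` the node is therefore stay-active, and there
is a copy at distance less than `2 δ ^ l ≤ 10 δ ρ` from it. -/
theorem OnlineInvariant.delivery_le (hδ : 2 ≤ δ) (hi : OnlineInvariant n o δ h s st)
    (hs : s.Invariant o) (ht : s.time ≤ History.time h) {v w : ℕ} (hov : o ≤ v) (hvn : v ≤ n)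
    (hw : ∀ x ≤ s.servingNode o (v, History.time h),
      (x, History.time h) ∈ replicas o st.sol → x ≤ w) :
    v ≤ w + 15 * (δ * s.radius o (v, History.time h)) := by
  obtain ⟨hou, huv, huρ⟩ := hs.servingNode_mem (r := (v, History.time h)) ht hov
  obtain ⟨x, hx⟩ := SquareState.servingTimes_nonempty (SquareState.candidates_nonempty
    (r := (v, History.time h)) hov (hs.origin_extended ht))
  rw [SquareState.mem_servingTimes, SquareState.mem_candidates,
    SquareState.mem_replicas_extended hs.origin ht] at hx
  obtain ⟨hx0, -, hx1, -, hx2⟩ := hx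
  simp only at *
  generalize s.servingNode o (v, History.time h) = u at *
  generalize s.radius o (v, History.time h) = ρ at *
  have hδρ : 2 * ρ ≤ δ * ρ := Nat.mul_le_mul_right ρ hδ
  suffices u ≤ w + 10 * (δ * ρ) by omega
  have hclose : u = o ∨ ∃ y, x ≤ y ∧ y ≤ History.time h ∧ (u, y) ∈ s.base ∪ s.tail := by
    rcases hx0 with hx0 | hx0
    · rcases hs.cover _ hx0 with h' | h' | ⟨y, h1, h2, h3⟩
      · exact Or.inl h'
      · exact Or.inr ⟨x, le_rfl, hx1, h'⟩
      · exact Or.inr ⟨y, h1, h2.trans ht, Finset.mem_union_left _ h3⟩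
    · exact Or.inl hx0.1
  have how := hw o hou (hi.copies_sub o hi.origin_mem)
  rcases hclose with rfl | ⟨y, hxy, hy, hyB⟩
  · omega
  rcases hy.eq_or_lt with rfl | hy
  · have : (u, History.time h) ∈ replicas o st.sol := by
      rcases Finset.mem_union.1 hyB with h' | h'
      · exact hi.base_now u h'
      · rcases hi.tail_now u h' with h' | h'
        · exact hi.copies_sub u h'
        · exact hi.base_now u h'
    have := hw u le_rfl this
    omega
  by_cases hu0 : u = 0
  · omega
  have hex : ∃ l, History.time h ≤ y + δ ^ l :=
    ⟨History.time h, (Nat.lt_pow_self (by omega)).le.trans (Nat.le_add_left _ _)⟩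
  by_cases hl : Nat.find hex ≤ Nat.clog δ n
  · obtain ⟨z, hz⟩ := hi.active _ hl u (by omega) (by omega) _ hyB rfl hy (Nat.find_spec hex)
    rw [Finset.mem_inter, mem_neighborhood (by omega) (by omega) (by omega)] at hz
    have hzw := hw z hz.2.1 (hi.copies_sub z hz.1)
    have hlt := Nat.lt_div_mul_add (pow_pos (show 0 < δ by omega) (Nat.find hex)) (a := u - 1)
    have hpow : δ ^ Nat.find hex ≤ 5 * (δ * ρ) := by
      rcases hm : Nat.find hex with _ | m
      · rw [pow_zero]; omega
      · have hmin := Nat.find_min hex (m := m) (by omega)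
        calc δ ^ (m + 1) = δ * δ ^ m := pow_succ' _ _
          _ ≤ δ * (5 * ρ) := Nat.mul_le_mul_left _ (by omega)
          _ = 5 * (δ * ρ) := by ring
    omega
  · -- beyond the top level, `5ρ` exceeds the length of the line
    have hmin := Nat.find_min hex (m := Nat.clog δ n) (by omega)
    have := Nat.le_pow_clog (show 1 < δ by omega) n
    omega

theorem deliveryCost_union_le {F G : Finset Edge} :
    deliveryCost (F ∪ G) ≤ deliveryCost F + deliveryCost G := by
  rw [deliveryCost, Finset.filter_union]
  exact Finset.card_union_le _ _

theorem storageCost_union_le {F G : Finset Edge} :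
    storageCost (F ∪ G) ≤ storageCost F + storageCost G := by
  rw [storageCost, Finset.filter_union]
  exact Finset.card_union_le _ _

theorem deliveryCost_onlineRun_le (hδ : 2 ≤ δ) (hv : h.Valid n o) :
    deliveryCost (onlineRun n o δ σ τ h).sol ≤ 15 * (δ * totalRadius o σ h.requests) := by
  induction h with
  | nil => simp [onlineRun, deliveryCost]
  | cons e h ih =>
    have ih := ih hv.of_cons
    cases e with
    | request v =>
      have hi := onlineRun_invariant (σ := σ) (τ := τ) (show 0 < δ by omega) hv.of_cons
      have harr := History.Valid.arrivals hv
      rw [History.requests_request] at harr ⊢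
      have hs := square_invariant σ harr.tail
      obtain ⟨hov, hvn⟩ := hv v List.mem_cons_self
      obtain ⟨hou, -, -⟩ := hs.servingNode_mem harr.time_le hov
      obtain ⟨w, -, -, hw, heq⟩ := exists_delivery_source
        (st := onlineRun n o δ σ τ h) v hou (hi.copies_sub _ hi.origin_mem)
      have hcost := hi.delivery_le hδ hs harr.time_le hov hvn hw
      have hrun : onlineRun n o δ σ τ (Event.request v :: h) = _ := heq
      rw [hrun, totalRadius]
      have h1 := deliveryCost_union_le (F := (onlineRun n o δ σ τ h).sol)
        (G := horPath w v (History.time h))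
      have h2 : deliveryCost (horPath w v (History.time h)) ≤ v - w :=
        (Finset.card_filter_le _ _).trans (card_horPath _ _ _).le
      simp only [mul_add]
      omega
    | tick =>
      rw [History.requests_tick, onlineRun]
      refine le_trans (deliveryCost_union_le.trans (le_of_eq ?_)) ih
      rw [Nat.add_eq_left, deliveryCost, Finset.card_eq_zero, Finset.filter_eq_empty_iff]
      intro e he hh
      obtain ⟨w, -, rfl⟩ := Finset.mem_image.1 he
      exact not_isArc_of_isHorizontal hh rfl

end Online

/-! ### The storage cost -/

/-- The indices `q` of the blocks of length `d` on which the edges of `F` are dense at time `t`: at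
least `d` heads lie within the block number `q` or its predecessor, not more than `2d` time units
ago. -/
def denseBlocks (n : ℕ) (F : Finset Edge) (d t : ℕ) : Finset ℕ :=
  (Finset.range n).filter fun q => d ≤ (F.filter fun e =>
    q * d < e.2.1 + d ∧ e.2.1 ≤ q * d + d ∧ t < e.2.2 + 2 * d ∧ e.2.2 ≤ t).card

/-- Double counting: each edge is counted for at most three blocks and `2d` time units. -/
theorem sum_card_denseBlocks_le (n : ℕ) (F : Finset Edge) {d : ℕ} (hd : 0 < d) (T : ℕ) :
    ∑ t ∈ Finset.range T, (denseBlocks n F d t).card ≤ 6 * F.card := by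
  rw [← Finset.card_sigma]
  set P := (Finset.range T).sigma (denseBlocks n F d) with hP
  let c : (Σ _ : ℕ, ℕ) → Edge → Prop := fun x e =>
    x.2 * d < e.2.1 + d ∧ e.2.1 ≤ x.2 * d + d ∧ x.1 < e.2.2 + 2 * d ∧ e.2.2 ≤ x.1
  let _ : ∀ x e, Decidable (c x e) := fun x e => inferInstanceAs (Decidable (_ ∧ _))
  have h1 : P.card * d ≤ ∑ x ∈ P, (F.filter fun e => c x e).card := by
    rw [← smul_eq_mul, ← Finset.sum_const]
    refine Finset.sum_le_sum fun x hx => ?_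
    exact (Finset.mem_filter.1 (Finset.mem_sigma.1 hx).2).2
  have h2 : ∑ x ∈ P, (F.filter fun e => c x e).card = ∑ e ∈ F, (P.filter fun x => c x e).card :=
    Finset.sum_card_bipartiteAbove_eq_sum_card_bipartiteBelow c
  have h3 : ∑ e ∈ F, (P.filter fun x => c x e).card ≤ ∑ _e ∈ F, 2 * d * 3 := by
    refine Finset.sum_le_sum fun e _ => ?_
    have hsub : (P.filter fun x => c x e) ⊆ (Finset.Ico e.2.2 (e.2.2 + 2 * d)).sigma
        fun _ => Finset.Ico (e.2.1 / d - 1) (e.2.1 / d + 2) := by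
      rintro ⟨t, q⟩ hx
      obtain ⟨-, h1, h2, h3, h4⟩ := Finset.mem_filter.1 hx
      simp only at h1 h2 h3 h4
      have h5 : q < e.2.1 / d + 2 := by
        by_contra hc
        have h6 := Nat.lt_div_mul_add hd (a := e.2.1)
        have h7 := Nat.mul_le_mul_right d (not_lt.1 hc)
        rw [add_mul] at h7
        omega
      have h6 : e.2.1 / d ≤ q + 1 := by
        refine (Nat.div_le_div_right (c := d) (b := (q + 1) * d) ?_).trans
          (Nat.mul_div_cancel _ hd).le
        rw [add_mul]; omega
      simp only [Finset.mem_sigma, Finset.mem_Ico]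
      omega
    refine (Finset.card_le_card hsub).trans ?_
    rw [Finset.card_sigma]
    simp only [Nat.card_Ico, Finset.sum_const, smul_eq_mul]
    exact Nat.mul_le_mul (by omega) (by omega)
  rw [Finset.sum_const, smul_eq_mul] at h3
  have h4 : P.card * d ≤ 6 * F.card * d := by
    calc P.card * d ≤ F.card * (2 * d * 3) := h1.trans (h2.le.trans h3)
      _ = 6 * F.card * d := by ring
  exact Nat.le_of_mul_le_mul_right h4 hd

/-- If a node is selected on level `l`, then the origin is not in its neighborhood, so that the path
of Square to the replica that makes the node stay-active has `δ ^ l` edges nearby. -/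
theorem mem_denseBlocks_of_stayActive {n o δ l v : ℕ} (hδ : 0 < δ) (h1 : 1 ≤ v) (hn : v ≤ n)
    {h : History} {s : SquareState} (hs : s.Invariant o) {F : Finset Edge} (hF : s.sol ⊆ F)
    {C : Finset ℕ} (hC : tailCopies o h s ⊆ C)
    (hact : StayActive δ l v (History.time h) (s.base ∪ s.tail))
    (he : C ∩ neighborhood n δ l v = ∅) :
    (v - 1) / δ ^ l ∈ denseBlocks n F (δ ^ l) (History.time h) := by
  obtain ⟨⟨x, y⟩, hp, rfl, hy, hy'⟩ := hact
  simp only at h1 hn he hy hy' ⊢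
  have hrep : (x, y) ∈ replicas o s.sol := by
    rcases Finset.mem_union.1 hp with hp | hp
    exacts [hs.base_sub hp, hs.tail_sub hp]
  have hox : o ≤ x := hs.le_node _ hrep
  have hoN : o ∉ neighborhood n δ l x := fun ho => by
    have : o ∈ C ∩ neighborhood n δ l x :=
      Finset.mem_inter.2 ⟨hC (Finset.mem_insert_self _ _), ho⟩
    rw [he] at this
    simp at this
  rw [mem_neighborhood hδ h1 hn] at hoN
  have hd : 0 < δ ^ l := pow_pos hδ l
  have hlt := Nat.lt_div_mul_add hd (a := x - 1)
  have hle := Nat.div_mul_le_self (x - 1) (δ ^ l)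
  have hbox := (hs.reaches _ hrep).le_card_box hs.grid (k := δ ^ l) (by simp only; omega)
  refine Finset.mem_filter.2 ⟨Finset.mem_range.2 ?_, hbox.trans (Finset.card_le_card ?_)⟩
  · have := Nat.div_le_self (x - 1) (δ ^ l)
    omega
  · intro e he
    rw [Finset.mem_filter] at he ⊢
    refine ⟨hF he.1, ?_⟩
    simp only at he
    omega

section Storage

variable {n o δ : ℕ} {σ : Selector (List Replica)} {τ : Selector (History × ℕ × ℕ)} {h : History}

/-- The copies that are stored in one round are the one at the origin, those on tails, and those that
are charged to dense blocks. The sets `F` and `U` bound the solution and the tails of Square. -/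
theorem storageCost_onlineRun_le_sum (hδ : 0 < δ) (hv : h.Valid n o) {F : Finset Edge}
    {U : Finset Replica} (hF : (square o σ h.requests).sol ⊆ F)
    (hU : (square o σ h.requests).tail ⊆ U) :
    storageCost (onlineRun n o δ σ τ h).sol ≤ ∑ t ∈ Finset.range (History.time h),
      (1 + (U.filter fun p => p.2 = t).card +
        ∑ l ∈ Finset.range (Nat.clog δ n + 1), (denseBlocks n F (δ ^ l) t).card) := by
  induction h with
  | nil => simp [onlineRun, storageCost]
  | cons e h ih =>
    have ih := ih hv.of_cons
    have hi := onlineRun_invariant (σ := σ) (τ := τ) hδ hv.of_cons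
    have harr := History.Valid.arrivals hv
    cases e with
    | request v =>
      rw [History.requests_request] at hF hU harr
      have hs := square_invariant σ harr.tail
      obtain ⟨hov, hvn⟩ := hv v List.mem_cons_self
      obtain ⟨hou, -, -⟩ := hs.servingNode_mem harr.time_le hov
      obtain ⟨w, -, -, -, heq⟩ := exists_delivery_source
        (st := onlineRun n o δ σ τ h) v hou (hi.copies_sub _ hi.origin_mem)
      have hrun : onlineRun n o δ σ τ (Event.request v :: h) = _ := heq
      rw [hrun]
      refine le_trans (storageCost_union_le.trans (le_of_eq ?_))
        (ih (square_sol_subset_cons.trans hF)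
          (fun p hp => hU (SquareState.mem_tail_serve.2 (Or.inl hp))))
      rw [Nat.add_eq_left, storageCost, Finset.card_eq_zero, Finset.filter_eq_empty_iff]
      exact fun e he ha => not_isArc_of_isHorizontal (horPath_isHorizontal he) ha
    | tick =>
      rw [History.requests_tick] at hF hU harr
      have hs := square_invariant σ harr
      have hT : History.time (Event.tick :: h) = History.time h + 1 := rfl
      rw [hT, Finset.sum_range_succ, onlineRun]
      refine storageCost_union_le.trans (Nat.add_le_add (ih hF hU) ?_)
      refine (Finset.card_filter_le _ _).trans (Finset.card_image_le.trans ?_)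
      refine (card_nextCopies_le hδ (hi.hasCandidates hδ)
        (fun l => denseBlocks n F (δ ^ l) (History.time h))
        (fun l _ v h1 hn C hC ha he => mem_denseBlocks_of_stayActive hδ h1 hn hs hF hC ha he)).trans
        (Nat.add_le_add_right ?_ _)
      refine (Finset.card_insert_le _ _).trans ?_
      rw [add_comm]
      exact Nat.add_le_add_left (Finset.card_image_le.trans
        (Finset.card_le_card (Finset.filter_subset_filter _ hU))) _

theorem storageCost_onlineRun_le (hδ : 0 < δ) (hv : h.Valid n o) :
    storageCost (onlineRun n o δ σ τ h).sol ≤ History.time h +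
      (2 * (square o σ h.requests).sol.card + 1) +
      (Nat.clog δ n + 1) * (6 * (square o σ h.requests).sol.card) := by
  have hs := square_invariant σ (History.Valid.arrivals hv)
  have h1 := storageCost_onlineRun_le_sum (τ := τ) hδ hv (σ := σ) subset_rfl subset_rfl
  rw [Finset.sum_add_distrib, Finset.sum_add_distrib, Finset.sum_comm] at h1
  have h2 : ∑ t ∈ Finset.range (History.time h),
      ((square o σ (History.requests h)).tail.filter fun p => p.2 = t).card ≤
      2 * (square o σ (History.requests h)).sol.card + 1 := by
    refine le_trans ?_ ((Finset.card_le_card hs.tail_sub).trans (card_replicas_le _ _))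
    rw [Finset.sum_card_fiberwise_eq_card_filter]
    exact Finset.card_filter_le _ _
  have h3 : ∑ l ∈ Finset.range (Nat.clog δ n + 1), ∑ t ∈ Finset.range (History.time h),
      (denseBlocks n (square o σ (History.requests h)).sol (δ ^ l) t).card ≤
      (Nat.clog δ n + 1) * (6 * (square o σ (History.requests h)).sol.card) := by
    refine (Finset.sum_le_sum fun l _ => sum_card_denseBlocks_le _ _ (pow_pos hδ l) _).trans ?_
    rw [Finset.sum_const, Finset.card_range, smul_eq_mul]
  rw [Finset.sum_const, Finset.card_range, smul_eq_mul, mul_one] at h1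
  omega

end Storage

/-! ### The interval base -/

theorem logb_two_le (y : ℝ) (hy : 0 < y) : Real.logb 2 y ≤ 2 / 3 * y := by
  have he := Real.exp_one_gt_d9
  have h2 := Real.log_two_gt_d9
  have h1 := Real.log_le_sub_one_of_pos (div_pos hy (Real.exp_pos 1))
  rw [Real.log_div hy.ne' (Real.exp_pos 1).ne', Real.log_exp] at h1
  have h3 : y / Real.exp 1 ≤ y * (2 / 5) := by
    rw [div_le_iff₀ (Real.exp_pos 1)]
    nlinarith
  rw [Real.logb, div_le_iff₀ (by linarith)]
  nlinarith

theorem three_halves_le_logb {n : ℕ} (hn : 3 ≤ n) : 3 / 2 ≤ Real.logb 2 n := by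
  have hn' : (3 : ℝ) ≤ n := by exact_mod_cast hn
  rw [Real.le_logb_iff_rpow_le (by norm_num) (by linarith)]
  refine le_trans ?_ hn'
  have : ((2 : ℝ) ^ (3 / 2 : ℝ)) ^ 2 ≤ 3 ^ 2 := by
    rw [← Real.rpow_natCast, ← Real.rpow_mul (by norm_num)]
    norm_num
  exact le_of_sq_le_sq this (by norm_num)

theorem logb_logb_pos {n : ℕ} (hn : 3 ≤ n) : 0 < Real.logb 2 (Real.logb 2 n) :=
  Real.logb_pos (by norm_num) (by linarith [three_halves_le_logb hn])

theorem three_halves_le_logRatio {n : ℕ} (hn : 3 ≤ n) : 3 / 2 ≤ logRatio n := by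
  have h1 := three_halves_le_logb hn
  have h2 := logb_two_le (Real.logb 2 n) (by linarith)
  rw [logRatio, le_div_iff₀ (logb_logb_pos hn)]
  linarith

theorem two_le_intervalBase {n : ℕ} (hn : 3 ≤ n) : 2 ≤ intervalBase n := by
  have h1 := three_halves_le_logRatio hn
  rw [intervalBase, Nat.succ_le_iff, Nat.lt_ceil]
  norm_num
  linarith

theorem intervalBase_le_two_mul {n : ℕ} (hn : 3 ≤ n) : (intervalBase n : ℝ) ≤ 2 * logRatio n := by
  have h1 := three_halves_le_logRatio hn
  have := Nat.ceil_lt_add_one (show 0 ≤ logRatio n by linarith)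
  rw [intervalBase]
  linarith

theorem intervalBase_le {n : ℕ} (hn : 3 ≤ n) : intervalBase n ≤ n := by
  rw [intervalBase, Nat.ceil_le, logRatio, div_le_iff₀ (logb_logb_pos hn)]
  have h1 := three_halves_le_logb hn
  rcases hn.eq_or_lt with rfl | hn
  · -- `log 3 ≤ 3 log (3 / 2)` because `8 ≤ 9`
    have h2 : Real.logb 2 (3 / 2) ≤ Real.logb 2 (Real.logb 2 (3 : ℕ)) :=
      Real.logb_le_logb_of_le (by norm_num) (by norm_num) h1
    rw [Real.logb_div (by norm_num) (by norm_num), Real.logb_self_eq_one (by norm_num)] at h2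
    push_cast at *
    linarith
  · have hn4 : (4 : ℝ) ≤ n := by exact_mod_cast hn
    have h2 : 2 ≤ Real.logb 2 n := by
      rw [Real.le_logb_iff_rpow_le (by norm_num) (by linarith)]
      norm_num
      linarith
    have h3 : 1 ≤ Real.logb 2 (Real.logb 2 n) := by
      rw [Real.le_logb_iff_rpow_le (by norm_num) (by linarith)]
      norm_num
      linarith
    have h4 : Real.logb 2 n ≤ n := by
      rw [Real.logb_le_iff_le_rpow (by norm_num) (by linarith), Real.rpow_natCast]
      exact_mod_cast (Nat.lt_two_pow_self (n := n)).le
    nlinarith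

/-- With `x = log n` and `y = log x`, the base is at least `x / y`, whose logarithm is
`y - log y ≥ y / 3`. -/
theorem logb_intervalBase_le {n : ℕ} (hn : 3 ≤ n) :
    Real.logb (intervalBase n) n ≤ 3 * logRatio n := by
  have h1 := three_halves_le_logb hn
  have hy := logb_logb_pos hn
  have h2 := logb_two_le _ hy
  have h3 := three_halves_le_logRatio hn
  have h4 : Real.logb 2 (logRatio n) ≤ Real.logb 2 (intervalBase n) :=
    Real.logb_le_logb_of_le (by norm_num) (by linarith) (Nat.le_ceil _)
  have h5 : Real.logb 2 (logRatio n) =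
      Real.logb 2 (Real.logb 2 n) - Real.logb 2 (Real.logb 2 (Real.logb 2 n)) :=
    Real.logb_div (by linarith) hy.ne'
  have h6 : Real.logb 2 (Real.logb 2 n) / 3 ≤ Real.logb 2 (intervalBase n) := by linarith
  have h8 : Real.logb (intervalBase n) n = Real.logb 2 n / Real.logb 2 (intervalBase n) :=
    (div_div_div_cancel_right₀ (Real.log_pos one_lt_two).ne' _ _).symm
  rw [h8, div_le_iff₀ (by linarith), logRatio]
  have h7 : Real.logb 2 n = 3 * (Real.logb 2 n / Real.logb 2 (Real.logb 2 n)) *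
      (Real.logb 2 (Real.logb 2 n) / 3) := by
    field_simp
  calc Real.logb 2 n = _ := h7
    _ ≤ _ := mul_le_mul_of_nonneg_left h6 (by positivity)

/-! ### The costs of the online algorithm -/

theorem Arrivals.of_isInstance {n o : ℕ} {R : List Replica} (hR : IsInstance n o R) :
    Arrivals o R.reverse :=
  ⟨List.pairwise_reverse.2 hR.1, fun r hr => (hR.2 r (List.mem_reverse.1 hr)).1⟩

theorem square_time_le_lastTime {o : ℕ} (σ : Selector (List Replica)) (R : List Replica) :
    (square o σ R.reverse).time ≤ lastTime R := by
  cases hl : R.reverse with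
  | nil => exact Nat.zero_le _
  | cons r L =>
    exact le_lastTime (List.mem_reverse.1 (by rw [hl]; exact List.mem_cons_self))

/-- A solution with paths to all requests of a nontrivial instance has an edge, and an arc for each
time unit. -/
theorem one_le_card_and_lastTime_le {n o : ℕ} {R : List Replica} (hR : IsInstance n o R)
    (hne : ∃ r ∈ R, r ≠ (o, 0)) {F : Finset Edge} (hF : ∀ e ∈ F, IsHorizontal e ∨ IsArc e)
    (hreach : ∀ r ∈ R, Reaches F (o, 0) r) : 1 ≤ F.card ∧ lastTime R ≤ F.card := by
  obtain ⟨⟨a, b⟩, hr, hro⟩ := hne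
  constructor
  · have hoa := (hR.2 _ hr).1
    refine ((hreach _ hr).le_card_box hF (k := 1) ?_).trans (Finset.card_filter_le _ _)
    simp only [ne_eq, Prod.mk.injEq] at hro hoa ⊢
    omega
  · obtain ⟨r', hr', heq⟩ := exists_eq_lastTime (List.ne_nil_of_mem hr)
    have hoa := (hR.2 _ hr').1
    refine ((hreach _ hr').le_card_box hF (k := lastTime R) ?_).trans (Finset.card_filter_le _ _)
    simp only
    omega

theorem squareCost_bounds {n o : ℕ} {R : List Replica} (hR : IsInstance n o R)
    (hne : ∃ r ∈ R, r ≠ (o, 0)) (σ : Selector (List Replica)) :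
    1 ≤ squareCost o σ R ∧ lastTime R ≤ squareCost o σ R := by
  have harr := Arrivals.of_isInstance hR
  have hs := square_invariant σ harr
  exact one_le_card_and_lastTime_le hR hne hs.grid fun r hr =>
    hs.reaches _ (mem_replicas_square σ harr (List.mem_reverse.2 hr))

theorem squareCost_le_opt {n o : ℕ} {R : List Replica} (hR : IsInstance n o R)
    (hne : ∃ r ∈ R, r ≠ (o, 0)) (σ : Selector (List Replica))
    (hfeas : ∃ F, Feasible n o R F) : squareCost o σ R ≤ 57 * opt n o R := by
  have harr := Arrivals.of_isInstance hR
  obtain ⟨F₀, hF₀⟩ := hfeas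
  obtain ⟨F, hF, hcard⟩ : opt n o R ∈ {k | ∃ F : Finset Edge, Feasible n o R F ∧ F.card = k} :=
    Nat.sInf_mem ⟨_, F₀, hF₀, rfl⟩
  have hgrid : ∀ e ∈ F, IsHorizontal e ∨ IsArc e := fun e he => (hF.1 e he).1
  have h1 := (one_le_card_and_lastTime_le hR hne hgrid hF.2).2
  have h2 := totalRadius_le_four_mul_card σ harr hgrid
    fun r hr => hF.2 r (List.mem_reverse.1 hr)
  have h3 := card_le_totalRadius σ harr
  have h4 := square_time_le_lastTime (o := o) σ R
  rw [squareCost]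
  omega

theorem deliveryCost_solution_le {n o δ : ℕ} (hδ : 2 ≤ δ) {R : List Replica}
    (hR : IsInstance n o R) (σ : Selector (List Replica)) (τ : Selector (History × ℕ × ℕ)) :
    deliveryCost ((dlineOn n o δ σ τ).solution R) ≤ 15 * (δ * squareCost o σ R) := by
  have h1 := deliveryCost_onlineRun_le (σ := σ) (τ := τ) hδ
    (valid_historyUpTo hR (lastTime R + 1))
  rw [requests_historyUpTo_lastTime hR.1] at h1
  have h2 := totalRadius_le_card σ (Arrivals.of_isInstance hR)
  exact h1.trans (Nat.mul_le_mul_left _ (Nat.mul_le_mul_left _ h2))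

theorem storageCost_solution_le {n o δ : ℕ} (hδ : 2 ≤ δ) (hδn : δ ≤ n) {R : List Replica}
    (hR : IsInstance n o R) (hne : ∃ r ∈ R, r ≠ (o, 0)) (σ : Selector (List Replica))
    (τ : Selector (History × ℕ × ℕ)) :
    (storageCost ((dlineOn n o δ σ τ).solution R) : ℝ) ≤
      23 * Real.logb δ n * (squareCost o σ R : ℝ) := by
  have h1 := storageCost_onlineRun_le (σ := σ) (τ := τ) (show 0 < δ by omega)
    (valid_historyUpTo hR (lastTime R + 1))
  rw [requests_historyUpTo_lastTime hR.1, time_historyUpTo] at h1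
  obtain ⟨h2, h3⟩ := squareCost_bounds hR hne σ
  have hδ' : (2 : ℝ) ≤ δ := by exact_mod_cast hδ
  have hδn' : (δ : ℝ) ≤ n := by exact_mod_cast hδn
  have hlog : 1 ≤ Real.logb δ n := by
    rw [Real.le_logb_iff_rpow_le (by linarith) (by linarith), Real.rpow_one]
    exact hδn'
  have hclog : (Nat.clog δ n : ℝ) ≤ Real.logb δ n + 1 := by
    rw [← Real.natCeil_logb_natCast]
    exact (Nat.ceil_lt_add_one (by linarith)).le
  have h4 : storageCost ((dlineOn n o δ σ τ).solution R) ≤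
      (11 + 6 * Nat.clog δ n) * squareCost o σ R := by
    have hS : (square o σ R.reverse).sol.card = squareCost o σ R := rfl
    rw [hS] at h1
    refine h1.trans ?_
    have : (11 + 6 * Nat.clog δ n) * squareCost o σ R = 5 * squareCost o σ R +
        (Nat.clog δ n + 1) * (6 * squareCost o σ R) := by ring
    omega
  calc (storageCost ((dlineOn n o δ σ τ).solution R) : ℝ)
      ≤ (11 + 6 * (Nat.clog δ n : ℝ)) * (squareCost o σ R : ℝ) := by exact_mod_cast h4
    _ ≤ 23 * Real.logb δ n * (squareCost o σ R : ℝ) :=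
      mul_le_mul_of_nonneg_right (by linarith) (Nat.cast_nonneg _)

theorem card_eq_deliveryCost_add_storageCost {F : Finset Edge}
    (hF : ∀ e ∈ F, IsHorizontal e ∨ IsArc e) : F.card = deliveryCost F + storageCost F := by
  rw [deliveryCost, storageCost, ← Finset.card_filter_add_card_filter_not (s := F) IsHorizontal]
  congr 2
  refine Finset.filter_congr fun e he => ?_
  exact ⟨fun h => (hF e he).resolve_left h, fun h h' => not_isArc_of_isHorizontal h' h⟩

theorem dlineOn_isCompetitive {n o : ℕ} (hn : 3 ≤ n) (ho : o ≤ n) (σ : Selector (List Replica))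
    (τ : Selector (History × ℕ × ℕ)) :
    IsCompetitive n o (dlineOn n o (intervalBase n) σ τ) (6555 * logRatio n) := by
  intro R hR hne
  have hδ := two_le_intervalBase hn
  have hfeas := (dlineOn_isOnline (σ := σ) (τ := τ) (n := n) (o := o)
    (show 0 < intervalBase n by omega)).feasible ho hR
  have h1 := deliveryCost_solution_le hδ hR σ τ
  have h2 := storageCost_solution_le hδ (intervalBase_le hn) hR hne σ τ
  have h3 := squareCost_le_opt hR hne σ ⟨_, hfeas⟩
  have h4 := intervalBase_le_two_mul hn
  have h5 := logb_intervalBase_le hn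
  have h6 := three_halves_le_logRatio hn
  rw [card_eq_deliveryCost_add_storageCost fun e he => (hfeas.1 e he).1]
  have h1' : (deliveryCost ((dlineOn n o (intervalBase n) σ τ).solution R) : ℝ) ≤
      15 * (intervalBase n * squareCost o σ R) := by exact_mod_cast h1
  have h3' : (squareCost o σ R : ℝ) ≤ 57 * opt n o R := by exact_mod_cast h3
  have hS : (0 : ℝ) ≤ squareCost o σ R := Nat.cast_nonneg _
  have h7 := mul_le_mul_of_nonneg_right h4 hS
  have h8 := mul_le_mul_of_nonneg_right h5 hS
  have h9 := mul_le_mul_of_nonneg_left h3' (show 0 ≤ logRatio n by linarith)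
  have h10 : 0 ≤ logRatio n * (opt n o R : ℝ) :=
    mul_nonneg (by linarith) (Nat.cast_nonneg _)
  push_cast
  linarith

end DMCD

theorem mainTheorem3 :
    (∃ K : ℝ, 0 < K ∧ ∀ n o : ℕ, 3 ≤ n → o ≤ n →
      ∀ (σ : DMCD.Selector (List DMCD.Replica)) (τ : DMCD.Selector (DMCD.History × ℕ × ℕ)),
        DMCD.IsOnline n o (DMCD.dlineOn n o (DMCD.intervalBase n) σ τ) ∧
        (∀ R, DMCD.IsInstance n o R →
          DMCD.Feasible n o R ((DMCD.dlineOn n o (DMCD.intervalBase n) σ τ).solution R)) ∧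
        DMCD.IsCompetitive n o (DMCD.dlineOn n o (DMCD.intervalBase n) σ τ)
          (K * DMCD.logRatio n)) ∧
    (∃ K : ℝ, 0 < K ∧ ∀ n o δ : ℕ, 2 ≤ δ → δ ≤ n → o ≤ n →
      ∀ (σ : DMCD.Selector (List DMCD.Replica)) (τ : DMCD.Selector (DMCD.History × ℕ × ℕ)),
        ∀ R, DMCD.IsInstance n o R → (∃ r ∈ R, r ≠ (o, 0)) →
          (DMCD.deliveryCost ((DMCD.dlineOn n o δ σ τ).solution R) : ℝ) ≤
            K * (δ : ℝ) * (DMCD.squareCost o σ R : ℝ) ∧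
          (DMCD.storageCost ((DMCD.dlineOn n o δ σ τ).solution R) : ℝ) ≤
            K * Real.logb δ n * (DMCD.squareCost o σ R : ℝ)) := by
  refine ⟨⟨6555, by norm_num, fun n o hn ho σ τ => ?_⟩,
    ⟨23, by norm_num, fun n o δ hδ hδn _ σ τ R hR hne => ⟨?_, ?_⟩⟩⟩
  · have honline : DMCD.IsOnline n o (DMCD.dlineOn n o (DMCD.intervalBase n) σ τ) :=
      DMCD.dlineOn_isOnline (by have := DMCD.two_le_intervalBase hn; omega)
    exact ⟨honline, fun R hR => honline.feasible ho hR, DMCD.dlineOn_isCompetitive hn ho σ τ⟩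
  · have h1 : (DMCD.deliveryCost ((DMCD.dlineOn n o δ σ τ).solution R) : ℝ) ≤
        15 * (δ * DMCD.squareCost o σ R) := by
      exact_mod_cast DMCD.deliveryCost_solution_le hδ hR σ τ
    have h2 : (0 : ℝ) ≤ δ * DMCD.squareCost o σ R := by positivity
    linarith
  · exact DMCD.storageCost_solution_le hδ hδn hR hne σ τ
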